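/- **Setting.** Let $(K,dk)$ be a measure space of field modes with measurable frequencies $\omega_k\in\mathbb R$, and let $a_k,a_k^\dagger$ be the bosonic annihilation and creation operators on the Fock space over $L^2(K,dk)$. Let $f\in L^2(K,dk)$ be the (cut-off) coupling to a two-level atom with ground state $|0\rangle$, excited state $|1\rangle$, bare frequency $\omega_0$, Lamb shift $\delta\omega$ and decay rate $\gamma$ (real numbers). Put $\omega_A=\omega_0+\delta\omega$, $b=i\,\delta\omega+\gamma$, $\sigma^+=|1\rangle\langle 0|$, $\sigma^-=|0\rangle\langle 1|$, and $$A(t)=\int dk\, f(k)e^{-i(\omega_k-\omega_A+i\gamma)t}a_k,\qquad A'(t)=\int dk\, \overline{f(k)}\,e^{i(\omega_k-\omega_A+i\gamma)t}a_k^\dagger ,$$ so that $[A(t),A'(s)]=F^r(t-s)$ with $F^r(t)=e^{i(\omega_A-i\gamma)t}\int dk\,e^{-i\omega_kt}|f(k)|^2$. The renormalized interaction-picture Hamiltonian is $$\tilde H(t)=\sigma^+A(t)+\sigma^-A'(t)+ib\,|1\rangle\langle 1| ,$$ and $S_{ij}(t,0)=\langle i|U_{I_r}(t,0)|j\rangle$,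 $i,j\in\{0,1\}$, is given by the Dyson series $$S_{ij}(t,0)=\sum_{n\ge0}(-i)^n\int_0^t dt_1\int_0^{t_1}dt_2\cdots\int_0^{t_{n-1}}dt_n\,\langle i|\tilde H(t_1)\cdots\tilde H(t_n)|j\rangle .$$ Let $N_{ij}(t)$ be the normally ordered series $$N_{11}=\mathbb 1_F+\sum_{n\ge1}(-i)^{2n}\int_0^t dt_1\cdots\int_0^{t_{2n-1}}dt_{2n}\,A'(t_2)A'(t_4)\cdots A'(t_{2n})\,A(t_1)A(t_3)\cdots A(t_{2n-1}),$$ $$N_{00}=\mathbb 1_F+\sum_{n\ge1}(-i)^{2n}\int_0^t dt_1\cdots\int_0^{t_{2n-1}}dt_{2n}\,A'(t_1)A'(t_3)\cdots A'(t_{2n-1})\,A(t_2)A(t_4)\cdots A(t_{2n}),$$ $$N_{01}=\sum_{n\ge1}(-i)^{2n-1}\int_0^t dt_1\cdots\int_0^{t_{2n-2}}dt_{2n-1}\,A'(t_1)A'(t_3)\cdots A'(t_{2n-1})\,A(t_2)A(t_4)\cdots A(t_{2n-2}),$$ $$N_{10}=\sum_{n\ge1}(-i)^{2n-1}\int_0^t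 dt_1\cdots\int_0^{t_{2n-2}}dt_{2n-1}\,A'(t_2)A'(t_4)\cdots A'(t_{2n-2})\,A(t_1)A(t_3)\cdots A(t_{2n-1}).$$ All operator series and integrals are understood through matrix elements between finite-particle vectors $a^\dagger(h_1)\cdots a^\dagger(h_q)|\mathrm{vac}\rangle$ and $a^\dagger(g_1)\cdots a^\dagger(g_p)|\mathrm{vac}\rangle$, with $h_r,g_s\in L^2(K,dk)$. A family of functions $(D_\varepsilon)$ is said to satisfy $D_\varepsilon\to b\,\delta(t)$ for $t>0$, along a filter in $\varepsilon$, if for all $0<\eta<T$: $\int_0^TD_\varepsilon\to b$, $\int_0^T|D_\varepsilon|$ is eventually bounded, and $\int_\eta^T|D_\varepsilon|\to0$. **Theorem.** Let $t\ge 0$ and $i,j\in\{0,1\}$. (a) *(The rule $F^r\Rightarrow b\delta$ at every order.)* Fix one model as above. Let $(D_\varepsilon)$ be continuous functions with $D_\varepsilon\to b\,\delta(t)$ for $t>0$, and let $S^{D}_{ij}(t,0)$ be the series obtained from the Dyson series by normally ordering every integrand $\langle i|\tilde H(t_1)\cdots\tilde H(t_n)|j\rangle$ and replacing each function $F^r(t_p-t_q)$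 that this produces by $D(t_p-t_q)$. Then, in every matrix element, the series of $S^{D_\varepsilon}_{ij}(t,0)$ (for each $\varepsilon$) and of $N_{ij}(t)$ converge absolutely, and $S^{D_\varepsilon}_{ij}(t,0)\to N_{ij}(t)$. (b) *(The propagators themselves.)* Consider a family of models, indexed by $\varepsilon$, on the same mode space and with the same $b$, whose functions satisfy $F^r_\varepsilon\to b\,\delta(t)$ for $t>0$. Then, in every fixed matrix element, the Dyson series of $S_{\varepsilon,ij}(t,0)$ and the series $N_{\varepsilon,ij}(t)$ converge absolutely for each $\varepsilon$, and $S_{\varepsilon,ij}(t,0)-N_{\varepsilon,ij}(t)\to0$. -/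

import Mathlib

open MeasureTheory Filter Topology
open scoped ComplexConjugate

noncomputable section

namespace AtomField

variable {K : Type*} [MeasurableSpace K]

/-- The one-photon space `L²(K, μ)`; `K` is the space of modes `k`, and `μ` is `dk`. -/
abbrev OnePhoton (μ : Measure K) : Type _ := Lp ℂ 2 μ

/-- The space of finite-particle vectors of the bosonic Fock space over `L²(K, μ)`: the symmetric
algebra over the one-photon space, with vacuum vector `1`. It is dense in the Fock space and is
invariant under all creation and annihilation operators. -/
abbrev Fock (μ : Measure K) : Type _ := SymmetricAlgebra ℂ (OnePhoton μ)

/-- Operators on the finite-particle vectors. -/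
abbrev FieldOp (μ : Measure K) : Type _ := Module.End ℂ (Fock μ)

variable {μ : Measure K}

/-- The creation operator `a†(g) = ∫ dk g(k) a†_k`: multiplication by the one-photon vector `g`. -/
def create (g : OnePhoton μ) : FieldOp μ :=
  LinearMap.mulLeft ℂ (SymmetricAlgebra.ι ℂ (OnePhoton μ) g)

/-- The algebra homomorphism `P ↦ P + ε a(g) P` (with `ε² = 0`) which sends a one-photon vector `h`
to `h + ε ⟪g, h⟫`. -/
def shift (g : OnePhoton μ) : Fock μ →ₐ[ℂ] TrivSqZeroExt (Fock μ) (Fock μ) :=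
  SymmetricAlgebra.lift
    ((TrivSqZeroExt.inlAlgHom ℂ (Fock μ) (Fock μ)).toLinearMap ∘ₗ
        SymmetricAlgebra.ι ℂ (OnePhoton μ)
      + ((TrivSqZeroExt.inrHom (Fock μ) (Fock μ)).restrictScalars ℂ) ∘ₗ
        (Algebra.linearMap ℂ (Fock μ)) ∘ₗ (innerSL ℂ g).toLinearMap)

/-- The annihilation operator `a(g) = ∫ dk conj(g(k)) a_k`: the derivation of the symmetric algebra
that kills the vacuum and sends a one-photon vector `h` to `⟪g, h⟫` times the vacuum. -/
def annihilate (g : OnePhoton μ) : FieldOp μ :=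
  ((TrivSqZeroExt.sndHom (Fock μ) (Fock μ)).restrictScalars ℂ) ∘ₗ (shift g).toLinearMap

/-- The vector `a†(g₁) ⋯ a†(g_p) |vac⟩`. -/
def ket (gs : List (OnePhoton μ)) : Fock μ := (gs.map create).prod 1

/-- The functional `φ ↦ ⟨a†(h₁) ⋯ a†(h_q) vac, φ⟩ = ⟨vac, a(h_q) ⋯ a(h₁) φ⟩`. -/
def bra (hs : List (OnePhoton μ)) (φ : Fock μ) : ℂ :=
  SymmetricAlgebra.algebraMapInv ((hs.reverse.map annihilate).prod φ)

/-- The matrix element of a field operator between `a†(h₁) ⋯ a†(h_q) |vac⟩` and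
`a†(g₁) ⋯ a†(g_p) |vac⟩`. -/
def matrixElement (hs gs : List (OnePhoton μ)) (T : FieldOp μ) : ℂ := bra hs (T (ket gs))

/-- The data of a two-level atom coupled to the field: dispersion relation `ω`, square-integrable
coupling `f`, atomic frequency `ω₀`, Lamb shift `δω` and decay rate `γ`. -/
structure Model (μ : Measure K) where
  /-- the frequency of the mode `k` -/
  ω : K → ℝ
  measurable_ω : Measurable ω
  /-- the coupling constant of the mode `k` -/
  f : K → ℂ
  memLp_f : MemLp f 2 μ
  /-- the bare atomic frequency -/
  ω₀ : ℝ
  /-- the Lamb shift -/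
  δω : ℝ
  /-- the decay rate -/
  γ : ℝ

namespace Model

variable (M : Model μ)

/-- `b = i δω + γ`. -/
def b : ℂ := Complex.I * M.δω + M.γ

/-- `ω_A = ω₀ + δω`. -/
def ωA : ℝ := M.ω₀ + M.δω

/-- `f(k, t) = f(k) exp(-i (ω_k - ω_A + iγ) t)`. -/
def fAt (t : ℝ) (k : K) : ℂ :=
  M.f k * Complex.exp (-Complex.I * (M.ω k - M.ωA + Complex.I * M.γ) * t)

/-- `f'(k, t) = conj(f(k)) exp(i (ω_k - ω_A + iγ) t)`. -/
def fAt' (t : ℝ) (k : K) : ℂ :=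
  conj (M.f k) * Complex.exp (Complex.I * (M.ω k - M.ωA + Complex.I * M.γ) * t)

lemma memLp_fAt (t : ℝ) : MemLp (M.fAt t) 2 μ := by
  have hm := M.measurable_ω
  refine MemLp.of_le_mul (c := Real.exp (M.γ * t)) M.memLp_f
    (M.memLp_f.1.mul (by fun_prop)) (Eventually.of_forall fun k => ?_)
  rw [fAt, norm_mul, Complex.norm_exp, mul_comm]
  simp

lemma memLp_fAt' (t : ℝ) : MemLp (M.fAt' t) 2 μ := by
  have hm := M.measurable_ω
  have hf : AEStronglyMeasurable (fun k => conj (M.f k)) μ :=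
    Complex.continuous_conj.comp_aestronglyMeasurable M.memLp_f.1
  refine MemLp.of_le_mul (c := Real.exp (-M.γ * t)) M.memLp_f
    (hf.mul (by fun_prop)) (Eventually.of_forall fun k => ?_)
  rw [fAt', norm_mul, Complex.norm_exp, mul_comm]
  simp

/-- `A(t) = ∫ dk f(k, t) a_k`. -/
def A (t : ℝ) : FieldOp μ := annihilate (star ((M.memLp_fAt t).toLp (M.fAt t)))

/-- `A'(t) = ∫ dk f'(k, t) a†_k`. -/
def A' (t : ℝ) : FieldOp μ := create ((M.memLp_fAt' t).toLp (M.fAt' t))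

/-- `F(t) = ∫ dk exp(-i ω_k t) |f(k)|²`. -/
def F (t : ℝ) : ℂ := ∫ k, Complex.exp (-Complex.I * M.ω k * t) * (‖M.f k‖ ^ 2 : ℝ) ∂μ

/-- `F^r(t) = exp(i (ω_A - iγ) t) F(t)`. -/
def Fr (t : ℝ) : ℂ := Complex.exp (Complex.I * (M.ωA - Complex.I * M.γ) * t) * M.F t

end Model

/-- The matrix, in the atomic basis `|0⟩` (ground), `|1⟩` (excited), of
`σ⁺ a(t) + σ⁻ a'(t) + i b |1⟩⟨1|`, with `σ⁺ = |1⟩⟨0|`, `σ⁻ = |0⟩⟨1|`; the entries lie in an arbitrary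
algebra `R` of field operators (or of formal expressions in them). -/
def interaction {R : Type*} [Ring R] [Algebra ℂ R] (a a' : ℝ → R) (b : ℂ) (t : ℝ) :
    Matrix (Fin 2) (Fin 2) R :=
  Matrix.single 1 0 (a t) + Matrix.single 0 1 (a' t)
    + Matrix.single 1 1 (algebraMap ℂ R (Complex.I * b))

/-- The time-ordered integral
`∫₀ᵗ dt₁ ∫₀^{t₁} dt₂ ⋯ ∫₀^{t_{n-1}} dt_n G(t₁, …, t_n)`; here `τ k` is `t_{k+1}`. -/
def simplexIntegral : (n : ℕ) → ℝ → ((Fin n → ℝ) → ℂ) → ℂ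
  | 0, _, G => G Fin.elim0
  | n + 1, t, G =>
      ∫ s in (0 : ℝ)..t, simplexIntegral n s fun τ => G (Fin.cons (α := fun _ => ℝ) s τ)

/-- The `n`-th term `(-i)ⁿ ∫₀ᵗ dt₁ ⋯ ∫₀^{t_{n-1}} dt_n L(⟨i| H(t₁) ⋯ H(t_n) |j⟩)` of the Dyson
series of `⟨i|U(t,0)|j⟩`, evaluated on a functional `L`. -/
def dysonTerm {R : Type*} [Ring R] (H : ℝ → Matrix (Fin 2) (Fin 2) R) (L : R → ℂ)
    (t : ℝ) (i j : Fin 2) (n : ℕ) : ℂ :=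
  (-Complex.I) ^ n *
    simplexIntegral n t fun τ => L ((List.ofFn fun k => H (τ k)).prod i j)

/-- The letters of formal words in the operators `A(t)` and `A'(t)`. -/
inductive Letter : Type
  /-- the letter `A(t)` -/
  | ann (t : ℝ)
  /-- the letter `A'(t)` -/
  | cre (t : ℝ)

/-- The algebra of formal noncommutative polynomials in the letters `A(t)` and `A'(t)`. -/
abbrev FormalOp : Type := MonoidAlgebra ℂ (FreeMonoid Letter)

namespace Model

variable (M : Model μ)

/-- The renormalized interaction Hamiltonian in the interaction picture. -/
def H (t : ℝ) : Matrix (Fin 2) (Fin 2) (FieldOp μ) := interaction M.A M.A' M.b t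

/-- The terms of the Dyson series of the matrix elements of `S_{ij}(t,0) = ⟨i|U_{I_r}(t,0)|j⟩`. -/
def propagatorTerm (hs gs : List (OnePhoton μ)) (t : ℝ) (i j : Fin 2) (n : ℕ) : ℂ :=
  dysonTerm M.H (matrixElement hs gs) t i j n

/-- The formal version of the Hamiltonian `H`. -/
def formalH (t : ℝ) : Matrix (Fin 2) (Fin 2) FormalOp :=
  interaction (fun s => MonoidAlgebra.of ℂ _ (FreeMonoid.of (Letter.ann s)))
    (fun s => MonoidAlgebra.of ℂ _ (FreeMonoid.of (Letter.cre s))) M.b t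

/-- The normally ordered (Wick) expansion of a word in the operators `A(t)`, `A'(t)`, in which every
commutator `[A(t), A'(s)]` produced by the reordering is given the value `D (t - s)`. -/
def wick (D : ℝ → ℂ) : List Letter → FieldOp μ
  | [] => 1
  | Letter.cre s :: w => M.A' s * wick D w
  | Letter.ann s :: w =>
      wick D w * M.A s + ∑ k : Fin w.length,
        match w[k] with
        | Letter.cre r => D (s - r) • wick D (w.eraseIdx k)
        | Letter.ann _ => 0
  termination_by w => w.length
  decreasing_by all_goals (simp [List.length_eraseIdx]; try omega)

/-- The linear extension of `wick` to formal polynomials. -/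
def wickPoly (D : ℝ → ℂ) (x : FormalOp) : FieldOp μ :=
  x.coeff.sum fun w c => c • M.wick D w.toList

/-- The terms of the Dyson series of the matrix elements of `S_{ij}(t,0)` after normal ordering, with
`F^r` replaced by `D` at every order. -/
def replacedTerm (D : ℝ → ℂ) (hs gs : List (OnePhoton μ)) (t : ℝ) (i j : Fin 2) (n : ℕ) : ℂ :=
  dysonTerm M.formalH (fun x => matrixElement hs gs (M.wickPoly D x)) t i j n

/-- `A'(t₂) A'(t₄) ⋯ A'(t_{2n}) A(t₁) A(t₃) ⋯ A(t_{2n-1})`. -/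
def normal11 (n : ℕ) (τ : Fin (2 * n) → ℝ) : FieldOp μ :=
  (List.ofFn fun k : Fin n => M.A' (τ ⟨2 * k + 1, by omega⟩)).prod *
    (List.ofFn fun k : Fin n => M.A (τ ⟨2 * k, by omega⟩)).prod

/-- `A'(t₁) A'(t₃) ⋯ A'(t_{2n-1}) A(t₂) A(t₄) ⋯ A(t_{2n})`. -/
def normal00 (n : ℕ) (τ : Fin (2 * n) → ℝ) : FieldOp μ :=
  (List.ofFn fun k : Fin n => M.A' (τ ⟨2 * k, by omega⟩)).prod *
    (List.ofFn fun k : Fin n => M.A (τ ⟨2 * k + 1, by omega⟩)).prod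

/-- `A'(t₁) A'(t₃) ⋯ A'(t_{2m+1}) A(t₂) A(t₄) ⋯ A(t_{2m})`, where `m = n - 1`. -/
def normal01 (m : ℕ) (τ : Fin (2 * m + 1) → ℝ) : FieldOp μ :=
  (List.ofFn fun k : Fin (m + 1) => M.A' (τ ⟨2 * k, by omega⟩)).prod *
    (List.ofFn fun k : Fin m => M.A (τ ⟨2 * k + 1, by omega⟩)).prod

/-- `A'(t₂) A'(t₄) ⋯ A'(t_{2m}) A(t₁) A(t₃) ⋯ A(t_{2m+1})`, where `m = n - 1`. -/
def normal10 (m : ℕ) (τ : Fin (2 * m + 1) → ℝ) : FieldOp μ :=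
  (List.ofFn fun k : Fin m => M.A' (τ ⟨2 * k + 1, by omega⟩)).prod *
    (List.ofFn fun k : Fin (m + 1) => M.A (τ ⟨2 * k, by omega⟩)).prod

/-- The terms of the normally ordered series. For the entries `11` and `00` the term of index `0` is
the matrix element of the identity; for `01` and `10` the index is `m = n - 1`. -/
def normalTerm (hs gs : List (OnePhoton μ)) (t : ℝ) : Fin 2 → Fin 2 → ℕ → ℂ
  | 1, 1, n => (-Complex.I) ^ (2 * n) *
      simplexIntegral (2 * n) t fun τ => matrixElement hs gs (M.normal11 n τ)
  | 0, 0, n => (-Complex.I) ^ (2 * n) *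
      simplexIntegral (2 * n) t fun τ => matrixElement hs gs (M.normal00 n τ)
  | 0, 1, m => (-Complex.I) ^ (2 * m + 1) *
      simplexIntegral (2 * m + 1) t fun τ => matrixElement hs gs (M.normal01 m τ)
  | 1, 0, m => (-Complex.I) ^ (2 * m + 1) *
      simplexIntegral (2 * m + 1) t fun τ => matrixElement hs gs (M.normal10 m τ)

end Model

/-- `D → b δ(t)` for `t > 0`, along the filter `l`: the family `D` is an approximate identity of mass
`b` on the half-line, that is `∫₀ᵀ g(s) D(s) ds → b g(0)` because the mass of `D` on `[0, T]` tends to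
`b`, its total variation there stays bounded, and it concentrates at `0`. -/
structure TendstoHalfDelta {ι : Type*} (D : ι → ℝ → ℂ) (l : Filter ι) (b : ℂ) : Prop where
  mass : ∀ T : ℝ, 0 < T → Tendsto (fun ε => ∫ s in (0 : ℝ)..T, D ε s) l (𝓝 b)
  bounded : ∀ T : ℝ, 0 < T → ∃ C : ℝ, ∀ᶠ ε in l, ∫ s in (0 : ℝ)..T, ‖D ε s‖ ≤ C
  tail : ∀ η T : ℝ, 0 < η → η < T →
    Tendsto (fun ε => ∫ s in η..T, ‖D ε s‖) l (𝓝 0)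

end AtomField

end

/-! Everything reduces to scalar recursions. Between finite-particle vectors, a creator standing on
the left deletes one outgoing particle at the price of an inner product, and an annihilator standing
on the right deletes one incoming particle. Read from the left, latest time first, the Wick-ordered
integrand is therefore a recursion `Coupling.amp` whose state consists of the atomic level, the
remaining particles and the list `V` of times of annihilators still to be contracted with a creator
at an earlier time. Integration over the simplex turns it into the Volterra recursions
`term_succ_zero` and `term_succ_one`. The series `N` obeys the same recursion with `D = 0` and `b =
0` (`Coupling.free`), and the true propagator is the case `D = F^r`, since Wick ordering is then an
operator identity (`propagatorTerm_eq`). So both halves of the theorem are instances of one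
statement about families of couplings, `tendsto_tsum_sub_tsum_free`.

Absolute convergence is a majorant argument (`sum_norm_term_le`). The sums of absolute values are
bounded by an exponential times the product over `v ∈ V` of `∫₀ᵗ |D(v - r)| dr`. Differentiating
this product accounts for the closing of a contraction; opening one costs at most the `L¹` norm of
`D`. Only that norm enters, so the bound is uniform along the family.

The limit rests on a cancellation (`integral_contraction_eq`). An annihilator at time `s` contracted
with the very next operator contributes `-∫₀ˢ D(s - r) S(r) dr`, which tends to `-b S(s)` and
cancels the renormalization term `b S(s)`. If a creator absorbs an outgoing particle in between, the
contraction must close at a still earlier time; since `D` concentrates at `0`, both times lie close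
to `s`, and the pairing, being bounded in `L²`, has small integral over a short interval. The
difference from the free series is thus a small error plus differences with one particle fewer, and
induction on the number of particles (`eventually_norm_defect_le`) finishes without a Gronwall
argument.

In the second half the pairings depend on `ε` as well. Their `L²` bound comes from a Schur test: the
Gram kernels of the field vectors are `F^r(s - r)` up to exponentials governed by `γ = re b`, hence
controlled by the same `L¹` bound. -/

namespace AtomField

/-! ### Sums over the deletion of one entry of a list -/

section EraseSum

variable {α β N : Type*} [AddCommMonoid N]

/-- The sum over the positions of a list of a function of the entry and of the remaining list. -/
def eraseSum (l : List α) (F : α → List α → N) : N :=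
  ∑ k : Fin l.length, F l[k] (l.eraseIdx k)

@[simp] lemma eraseSum_nil (F : α → List α → N) : eraseSum [] F = 0 := by
  simp [eraseSum]

@[simp] lemma eraseSum_cons (a : α) (l : List α) (F : α → List α → N) :
    eraseSum (a :: l) F = F a l + eraseSum l fun x l' => F x (a :: l') := by
  unfold eraseSum
  exact Fin.sum_univ_succ (n := l.length) _

lemma eraseSum_congr {l : List α} {F G : α → List α → N}
    (h : ∀ x ∈ l, ∀ l', l'.Sublist l → F x l' = G x l') : eraseSum l F = eraseSum l G :=
  Finset.sum_congr rfl fun _ _ => h _ (List.getElem_mem _) _ (List.eraseIdx_sublist _ _)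

lemma eraseSum_map (f : β → α) (l : List β) (F : α → List α → N) :
    eraseSum (l.map f) F = eraseSum l fun x l' => F (f x) (l'.map f) := by
  induction l generalizing F with
  | nil => simp
  | cons a l ih => simp [ih]

lemma eraseSum_append_singleton (l : List α) (v : α) (F : α → List α → N) :
    eraseSum (l ++ [v]) F = (eraseSum l fun x l' => F x (l' ++ [v])) + F v l := by
  induction l generalizing F with
  | nil => simp
  | cons a l ih => simp [ih, add_assoc]

lemma eraseSum_add (l : List α) (F G : α → List α → N) :
    (eraseSum l fun x l' => F x l' + G x l') = eraseSum l F + eraseSum l G :=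
  Finset.sum_add_distrib

@[simp] lemma eraseSum_zero (l : List α) : (eraseSum l fun _ _ => (0 : N)) = 0 := by
  simp [eraseSum]

lemma eraseSum_comm (l : List α) (l₂ : List β) (F : α → List α → β → List β → N) :
    (eraseSum l fun x l' => eraseSum l₂ fun y l₂' => F x l' y l₂')
      = eraseSum l₂ fun y l₂' => eraseSum l fun x l' => F x l' y l₂' :=
  Finset.sum_comm

lemma map_eraseSum {N' T : Type*} [AddCommMonoid N'] [FunLike T N N'] [AddMonoidHomClass T N N']
    (φ : T) (l : List α) (F : α → List α → N) :
    φ (eraseSum l F) = eraseSum l fun x l' => φ (F x l') :=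
  map_sum φ _ _

lemma mul_eraseSum {R : Type*} [NonUnitalNonAssocSemiring R] (c : R) (l : List α)
    (F : α → List α → R) : c * eraseSum l F = eraseSum l fun x l' => c * F x l' :=
  Finset.mul_sum _ _ _

lemma eraseSum_mul {R : Type*} [NonUnitalNonAssocSemiring R] (c : R) (l : List α)
    (F : α → List α → R) : eraseSum l F * c = eraseSum l fun x l' => F x l' * c :=
  Finset.sum_mul _ _ _

lemma eraseSum_le {l : List α} {F G : α → List α → ℝ}
    (h : ∀ x ∈ l, ∀ l', l'.Sublist l → F x l' ≤ G x l') : eraseSum l F ≤ eraseSum l G :=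
  Finset.sum_le_sum fun _ _ => h _ (List.getElem_mem _) _ (List.eraseIdx_sublist _ _)

lemma norm_eraseSum_le {E : Type*} [SeminormedAddCommGroup E] (l : List α) (F : α → List α → E) :
    ‖eraseSum l F‖ ≤ eraseSum l fun x l' => ‖F x l'‖ :=
  norm_sum_le _ _

lemma eraseSum_const (l : List α) (F : α → N) :
    (eraseSum l fun x _ => F x) = (l.map F).sum := by
  induction l with
  | nil => simp
  | cons a l ih => simp [ih]

end EraseSum

/-! ### Creation and annihilation operators on the symmetric algebra -/

section Fock

variable {K : Type*} [MeasurableSpace K] {μ : Measure K}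

/-- An algebra homomorphism into the square-zero extension whose first component is the identity is
the same thing as a derivation; this is what yields the Leibniz rule `annihilate_mul`. -/
lemma fst_shift (g : OnePhoton μ) (x : Fock μ) : (shift g x).fst = x := by
  have : (TrivSqZeroExt.fstHom ℂ (Fock μ) (Fock μ)).comp (shift g) = AlgHom.id ℂ _ := by
    apply SymmetricAlgebra.algHom_ext
    ext h
    simp [shift]
  exact DFunLike.congr_fun this x

lemma annihilate_mul (g : OnePhoton μ) (x y : Fock μ) :
    annihilate g (x * y) = x * annihilate g y + annihilate g x * y := by
  simp [annihilate, TrivSqZeroExt.snd_mul, fst_shift]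

@[simp] lemma annihilate_one (g : OnePhoton μ) : annihilate g (1 : Fock μ) = 0 := by
  simp [annihilate]

@[simp] lemma annihilate_algebraMap (g : OnePhoton μ) (c : ℂ) :
    annihilate g (algebraMap ℂ (Fock μ) c) = 0 := by
  rw [Algebra.algebraMap_eq_smul_one, map_smul, annihilate_one, smul_zero]

@[simp] lemma annihilate_ι (g h : OnePhoton μ) :
    annihilate g (SymmetricAlgebra.ι ℂ _ h) = algebraMap ℂ (Fock μ) (inner ℂ g h) := by
  simp [annihilate, shift, Algebra.algebraMap_eq_smul_one]

/-- Both compositions vanish on scalars and on one-photon vectors, and the Leibniz rule expands them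
symmetrically on products. -/
lemma annihilate_comm (g h : OnePhoton μ) : Commute (annihilate g) (annihilate h) := by
  refine LinearMap.ext fun x => ?_
  change annihilate g (annihilate h x) = annihilate h (annihilate g x)
  induction x using SymmetricAlgebra.induction with
  | algebraMap r => simp
  | ι x => simp
  | mul a b ha hb => simp only [annihilate_mul, map_add, ha, hb]; ring
  | add a b ha hb => simp only [map_add, ha, hb]

lemma create_apply (g : OnePhoton μ) (x : Fock μ) :
    create g x = SymmetricAlgebra.ι ℂ _ g * x := rfl

lemma annihilate_create (g h : OnePhoton μ) :
    annihilate g * create h = create h * annihilate g + (inner ℂ g h : ℂ) • 1 := by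
  refine LinearMap.ext fun x => ?_
  simp [create_apply, annihilate_mul, Algebra.smul_def]

lemma ket_cons (g : OnePhoton μ) (gs : List (OnePhoton μ)) :
    ket (g :: gs) = SymmetricAlgebra.ι ℂ _ g * ket gs := by
  simp [ket, create_apply]

lemma bra_cons (h : OnePhoton μ) (hs : List (OnePhoton μ)) (x : Fock μ) :
    bra (h :: hs) x = bra hs (annihilate h x) := by
  simp [bra]

/-- `bra` as a linear functional. -/
noncomputable def braLin (hs : List (OnePhoton μ)) : Fock μ →ₗ[ℂ] ℂ :=
  SymmetricAlgebra.algebraMapInv.toLinearMap ∘ₗ (hs.reverse.map annihilate).prod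

lemma braLin_apply (hs : List (OnePhoton μ)) (x : Fock μ) : braLin hs x = bra hs x := rfl

/-- `matrixElement` as a linear functional. -/
noncomputable def matrixElementLin (hs gs : List (OnePhoton μ)) : FieldOp μ →ₗ[ℂ] ℂ :=
  braLin hs ∘ₗ LinearMap.applyₗ (ket gs)

lemma matrixElementLin_apply (hs gs : List (OnePhoton μ)) (T : FieldOp μ) :
    matrixElementLin hs gs T = matrixElement hs gs T := rfl

lemma annihilate_ket (f : OnePhoton μ) (gs : List (OnePhoton μ)) :
    annihilate f (ket gs) = eraseSum gs fun g gs' => (inner ℂ f g : ℂ) • ket gs' := by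
  induction gs with
  | nil => simp [ket]
  | cons g gs ih =>
    rw [ket_cons, annihilate_mul, ih, mul_eraseSum, eraseSum_cons, annihilate_ι, add_comm,
      ← Algebra.smul_def]
    simp only [ket_cons, mul_smul_comm]

lemma bra_create (f : OnePhoton μ) (hs : List (OnePhoton μ)) (x : Fock μ) :
    bra hs (create f x) = eraseSum hs fun h hs' => (inner ℂ h f : ℂ) * bra hs' x := by
  induction hs generalizing x with
  | nil => simp [bra, create_apply, SymmetricAlgebra.algebraMapInv_ι]
  | cons h hs ih =>
    rw [bra_cons, eraseSum_cons, create_apply, annihilate_mul, annihilate_ι, ← braLin_apply,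
      map_add, ← Algebra.smul_def, map_smul, braLin_apply, braLin_apply, ← create_apply, ih,
      add_comm, smul_eq_mul]
    simp only [bra_cons]

lemma matrixElement_create_mul (f : OnePhoton μ) (hs gs : List (OnePhoton μ)) (T : FieldOp μ) :
    matrixElement hs gs (create f * T)
      = eraseSum hs fun h hs' => (inner ℂ h f : ℂ) * matrixElement hs' gs T :=
  bra_create f hs _

lemma matrixElement_mul_annihilate (f : OnePhoton μ) (hs gs : List (OnePhoton μ))
    (T : FieldOp μ) :
    matrixElement hs gs (T * annihilate f)
      = eraseSum gs fun g gs' => (inner ℂ f g : ℂ) * matrixElement hs gs' T := by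
  simp only [matrixElement, Module.End.mul_apply, annihilate_ket, map_eraseSum, map_smul,
    ← braLin_apply, smul_eq_mul]

end Fock

/-! ### Matrix elements of Wick-ordered words -/

/-- The value of the contraction of `A(v)` with a letter, for the commutator function `D`. -/
def Letter.contraction (D : ℝ → ℂ) (v : ℝ) : Letter → ℂ
  | Letter.cre r => D (v - r)
  | Letter.ann _ => 0

/-- The data that determine the matrix elements of normally ordered words: the pairings `w h s` and
`u g s` of outgoing and incoming particles with the field operators at time `s`, the commutator
function `D`, the constant `b` of the interaction, the scalar products `c hs gs` of many-particle
vectors, and the final atomic state `j` of the Dyson series. -/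
structure Coupling (α β : Type*) where
  /-- pairing of an outgoing particle with the creation operator at a given time -/
  w : α → ℝ → ℂ
  /-- pairing of an incoming particle with the annihilation operator at a given time -/
  u : β → ℝ → ℂ
  /-- the commutator function -/
  D : ℝ → ℂ
  /-- the coefficient of the projection to the excited state -/
  b : ℂ
  /-- scalar products of many-particle vectors -/
  c : List α → List β → ℂ
  /-- the atomic state on the right -/
  j : Fin 2

namespace Coupling

variable {α β : Type*} (P : Coupling α β)

/-- The matrix element of the normal ordering of `A(V₁) A(V₂) ⋯ w` restricted to the terms in which
all the operators `A(Vₖ)` are contracted with letters of `w`. -/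
noncomputable def wordAmp : List ℝ → List α → List β → List Letter → ℂ
  | V, hs, gs, [] => if V = [] then P.c hs gs else 0
  | V, hs, gs, Letter.cre s :: w =>
      (eraseSum hs fun h hs' => P.w h s * wordAmp V hs' gs w)
        + eraseSum V fun v V' => P.D (v - s) * wordAmp V' hs gs w
  | V, hs, gs, Letter.ann s :: w =>
      (eraseSum gs fun g gs' => P.u g s * wordAmp V hs gs' w) + wordAmp (s :: V) hs gs w

/-- The pending time `v` is eventually matched with some letter of the word, and the recursion
treats all other letters as if that letter were absent. New annihilators are put at the front of
`V`, so `v` stays last throughout; this is why the statement is about `V ++ [v]` and not `v :: V`.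
-/
lemma wordAmp_append_singleton (V : List ℝ) (v : ℝ) (hs : List α) (gs : List β)
    (w : List Letter) :
    P.wordAmp (V ++ [v]) hs gs w
      = eraseSum w fun x w' => x.contraction P.D v * P.wordAmp V hs gs w' := by
  induction w generalizing V hs gs with
  | nil => simp [wordAmp]
  | cons x w ih =>
    cases x with
    | cre s =>
      simp only [wordAmp, eraseSum_cons, Letter.contraction, eraseSum_append_singleton, ih,
        mul_add, eraseSum_add, mul_eraseSum]
      rw [eraseSum_comm w hs, eraseSum_comm w V]
      simp only [mul_left_comm]
      ring
    | ann s =>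
      simp only [wordAmp, eraseSum_cons, Letter.contraction, mul_add, eraseSum_add, mul_eraseSum,
        zero_mul, ← List.cons_append, ih]
      rw [eraseSum_comm w gs]
      simp only [mul_left_comm]
      ring

end Coupling

namespace Model

variable {K : Type*} [MeasurableSpace K] {μ : Measure K} (M : Model μ)

/-- The one-photon vector `φ` with `A(t) = a(φ)`. -/
noncomputable def annVec (t : ℝ) : OnePhoton μ := star ((M.memLp_fAt t).toLp (M.fAt t))

/-- The one-photon vector `φ` with `A'(t) = a†(φ)`. -/
noncomputable def creVec (t : ℝ) : OnePhoton μ := (M.memLp_fAt' t).toLp (M.fAt' t)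

lemma A_eq (t : ℝ) : M.A t = annihilate (M.annVec t) := rfl

lemma A'_eq (t : ℝ) : M.A' t = create (M.creVec t) := rfl

/-- The coupling data of a model, with a given commutator function. -/
noncomputable def coupling (D : ℝ → ℂ) (b : ℂ) (j : Fin 2) :
    Coupling (OnePhoton μ) (OnePhoton μ) where
  w h s := inner ℂ h (M.creVec s)
  u g s := inner ℂ (M.annVec s) g
  D := D
  b := b
  c hs gs := matrixElement hs gs 1
  j := j

lemma wick_cre (D : ℝ → ℂ) (s : ℝ) (w : List Letter) :
    M.wick D (Letter.cre s :: w) = M.A' s * M.wick D w := by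
  rw [wick]

lemma wick_ann (D : ℝ → ℂ) (s : ℝ) (w : List Letter) :
    M.wick D (Letter.ann s :: w) = M.wick D w * M.A s
      + eraseSum w fun x w' => x.contraction D s • M.wick D w' := by
  rw [wick]
  congr 1
  refine Finset.sum_congr rfl fun k _ => ?_
  cases h : w[k] with
  | cre r => rfl
  | ann r => simp [Letter.contraction]

/-- Wick's recursion chooses the partner of an annihilator at once, whereas `wordAmp` keeps its time
pending until the partner is met. The two agree by `wordAmp_append_singleton` with `V = []`. The
induction is on length because contraction removes a letter from the middle of the word. -/
lemma matrixElement_wick (D : ℝ → ℂ) (b : ℂ) (j : Fin 2) (hs gs : List (OnePhoton μ))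
    (w : List Letter) :
    matrixElement hs gs (M.wick D w) = (M.coupling D b j).wordAmp [] hs gs w := by
  induction hn : w.length using Nat.strong_induction_on generalizing w hs gs with
  | _ n ih =>
    subst hn
    cases w with
    | nil => simp [wick, Coupling.wordAmp, coupling]
    | cons x w =>
      have ih' : ∀ w' : List Letter, w'.Sublist w → ∀ hs gs, matrixElement hs gs (M.wick D w')
          = (M.coupling D b j).wordAmp [] hs gs w' := fun w' h hs gs =>
        ih w'.length (by have := h.length_le; simp; omega) hs gs w' rfl
      cases x with
      | cre s =>
        rw [wick_cre, A'_eq, matrixElement_create_mul, Coupling.wordAmp]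
        simp only [ih' w (List.Sublist.refl _)]
        simp [coupling]
      | ann s =>
        rw [wick_ann, A_eq, ← matrixElementLin_apply, map_add, map_eraseSum, Coupling.wordAmp,
          ← List.nil_append [s], Coupling.wordAmp_append_singleton, matrixElementLin_apply,
          matrixElement_mul_annihilate]
        simp only [ih' w (List.Sublist.refl _)]
        congr 1
        refine eraseSum_congr fun x _ w' hw' => ?_
        rw [map_smul, matrixElementLin_apply, ih' w' hw', smul_eq_mul]
        rfl

/-- `wickPoly` as a linear map. -/
noncomputable def wickLin (D : ℝ → ℂ) : FormalOp →ₗ[ℂ] FieldOp μ :=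
  (Finsupp.lsum ℂ fun w : FreeMonoid Letter =>
    (LinearMap.id.smulRight (M.wick D w.toList) : ℂ →ₗ[ℂ] FieldOp μ)) ∘ₗ
      (MonoidAlgebra.coeffLinearEquiv ℂ).toLinearMap

lemma wickLin_apply (D : ℝ → ℂ) (x : FormalOp) : M.wickLin D x = M.wickPoly D x := rfl

/-- The product of the operators of a word. -/
noncomputable def wordOp (w : List Letter) : FieldOp μ :=
  (w.map fun x => match x with
    | Letter.ann s => M.A s
    | Letter.cre s => M.A' s).prod

/-- Moving `A(s)` to the right end of the word, each creator passed leaves its commutator with that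
letter deleted. The hypothesis is the value of the commutator. -/
lemma A_mul_wordOp (hFr : ∀ s r, inner ℂ (M.annVec s) (M.creVec r) = M.Fr (s - r)) (s : ℝ)
    (w : List Letter) :
    M.A s * M.wordOp w = M.wordOp w * M.A s
      + eraseSum w fun x w' => x.contraction M.Fr s • M.wordOp w' := by
  induction w with
  | nil => simp [wordOp]
  | cons x w ih =>
    -- `X` is the operator of the first letter; only its commutation rule with `A(s)` matters, so
    -- both kinds of letter are treated together.
    obtain ⟨X, hcons, hx⟩ : ∃ X, (∀ w', M.wordOp (x :: w') = X * M.wordOp w') ∧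
        M.A s * X = X * M.A s + x.contraction M.Fr s • 1 := by
      refine ⟨M.wordOp [x], fun w' => by simp [wordOp], ?_⟩
      cases x with
      | ann r =>
        have h := (annihilate_comm (M.annVec s) (M.annVec r)).eq
        simp only [wordOp, List.map_cons, List.map_nil, List.prod_cons, List.prod_nil, mul_one,
          Letter.contraction, zero_smul, add_zero]
        exact h
      | cre r => simp [wordOp, Letter.contraction, A_eq, A'_eq, annihilate_create, hFr]
    simp only [hcons, eraseSum_cons]
    rw [← mul_assoc, hx, add_mul, mul_assoc, ih, mul_add, mul_eraseSum, ← mul_assoc]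
    simp only [mul_smul_comm, smul_mul_assoc, one_mul]
    abel

lemma wordOp_eq_wick (hFr : ∀ s r, inner ℂ (M.annVec s) (M.creVec r) = M.Fr (s - r))
    (w : List Letter) : M.wordOp w = M.wick M.Fr w := by
  induction hn : w.length using Nat.strong_induction_on generalizing w with
  | _ n ih =>
    subst hn
    cases w with
    | nil => simp [wick, wordOp]
    | cons x w =>
      have ih' : ∀ w' : List Letter, w'.Sublist w → M.wordOp w' = M.wick M.Fr w' := fun w' h =>
        ih w'.length (by have := h.length_le; simp; omega) w' rfl
      cases x with
      | cre s => rw [wick_cre, ← ih' w (List.Sublist.refl _)]; simp [wordOp]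
      | ann s =>
        have : M.wordOp (Letter.ann s :: w) = M.A s * M.wordOp w := by simp [wordOp]
        rw [wick_ann, ← ih' w (List.Sublist.refl _), this, M.A_mul_wordOp hFr]
        congr 1
        exact eraseSum_congr fun x _ w' hw' => by rw [ih' w' hw']

end Model

/-! ### The Dyson integrand as a recursion over the atomic state -/

namespace Coupling

variable {α β : Type*} (P : Coupling α β)

/-- The integrand of the Dyson series at the times `τ` (latest first), started in the atomic state
`i`, with all the pending contractions at the times in `V` performed. -/
noncomputable def amp : Fin 2 → List ℝ → List α → List β → List ℝ → ℂ
  | i, V, hs, gs, [] => if i = P.j ∧ V = [] then P.c hs gs else 0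
  | 0, V, hs, gs, s :: τ =>
      (eraseSum hs fun h hs' => P.w h s * amp 1 V hs' gs τ)
        + eraseSum V fun v V' => P.D (v - s) * amp 1 V' hs gs τ
  | 1, V, hs, gs, s :: τ =>
      Complex.I * P.b * amp 1 V hs gs τ
        + ((eraseSum gs fun g gs' => P.u g s * amp 0 V hs gs' τ) + amp 0 (s :: V) hs gs τ)

/-- The linear extension of `wordAmp` to formal polynomials. -/
noncomputable def wordLin (V : List ℝ) (hs : List α) (gs : List β) : FormalOp →ₗ[ℂ] ℂ :=
  (Finsupp.lsum ℂ fun w : FreeMonoid Letter =>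
    (LinearMap.id.smulRight (P.wordAmp V hs gs w.toList) : ℂ →ₗ[ℂ] ℂ)) ∘ₗ
      (MonoidAlgebra.coeffLinearEquiv ℂ).toLinearMap

lemma wordLin_single (V : List ℝ) (hs : List α) (gs : List β) (w : FreeMonoid Letter) (r : ℂ) :
    P.wordLin V hs gs (MonoidAlgebra.single w r) = r * P.wordAmp V hs gs w.toList := by
  change (Finsupp.lsum ℂ fun w : FreeMonoid Letter =>
    (LinearMap.id.smulRight (P.wordAmp V hs gs w.toList) : ℂ →ₗ[ℂ] ℂ)) (Finsupp.single w r) = _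
  simp

lemma wordLin_cre_mul (V : List ℝ) (hs : List α) (gs : List β) (s : ℝ) (x : FormalOp) :
    P.wordLin V hs gs (MonoidAlgebra.of ℂ _ (FreeMonoid.of (Letter.cre s)) * x)
      = (eraseSum hs fun h hs' => P.w h s * P.wordLin V hs' gs x)
        + eraseSum V fun v V' => P.D (v - s) * P.wordLin V' hs gs x := by
  induction x using MonoidAlgebra.induction_linear with
  | zero => simp
  | add x y hx hy =>
    simp only [mul_add, map_add, hx, hy, eraseSum_add]
    ring
  | single w r =>
    simp only [MonoidAlgebra.of_apply, MonoidAlgebra.single_mul_single, wordLin_single,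
      FreeMonoid.toList_of_mul, wordAmp, one_mul, mul_add, mul_eraseSum, mul_left_comm]

lemma wordLin_ann_mul (V : List ℝ) (hs : List α) (gs : List β) (s : ℝ) (x : FormalOp) :
    P.wordLin V hs gs (MonoidAlgebra.of ℂ _ (FreeMonoid.of (Letter.ann s)) * x)
      = (eraseSum gs fun g gs' => P.u g s * P.wordLin V hs gs' x)
        + P.wordLin (s :: V) hs gs x := by
  induction x using MonoidAlgebra.induction_linear with
  | zero => simp
  | add x y hx hy =>
    simp only [mul_add, map_add, hx, hy, eraseSum_add]
    ring
  | single w r =>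
    simp only [MonoidAlgebra.of_apply, MonoidAlgebra.single_mul_single, wordLin_single,
      FreeMonoid.toList_of_mul, wordAmp, one_mul, mul_add, mul_eraseSum, mul_left_comm]

end Coupling

section Interaction

variable {R : Type*} [Ring R] [Algebra ℂ R] (a a' : ℝ → R) (b : ℂ) (t : ℝ)

lemma interaction_mul_zero (X : Matrix (Fin 2) (Fin 2) R) (j : Fin 2) :
    (interaction a a' b t * X) 0 j = a' t * X 1 j := by
  simp [interaction, Matrix.mul_apply, Matrix.single_apply]

lemma interaction_mul_one (X : Matrix (Fin 2) (Fin 2) R) (j : Fin 2) :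
    (interaction a a' b t * X) 1 j = a t * X 0 j + (Complex.I * b) • X 1 j := by
  simp [interaction, Matrix.mul_apply, Fin.sum_univ_two, Matrix.single_apply, Algebra.smul_def]

lemma interaction_map {S : Type*} [Ring S] [Algebra ℂ S] (φ : R →ₐ[ℂ] S) :
    φ.mapMatrix (interaction a a' b t)
      = interaction (fun s => φ (a s)) (fun s => φ (a' s)) b t := by
  simp only [interaction, map_add, AlgHom.mapMatrix_apply, Matrix.map_single _ _ _ φ,
    AlgHom.commutes]

end Interaction

namespace Model

variable {K : Type*} [MeasurableSpace K] {μ : Measure K} (M : Model μ)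

/-- The rows of the Hamiltonian are the transitions of the recursion: row `0` holds only `A'`, row
`1` holds `A` and the scalar `ib`. -/
lemma amp_eq_wordLin (D : ℝ → ℂ) (i j : Fin 2) (V : List ℝ) (hs gs : List (OnePhoton μ))
    (τ : List ℝ) :
    (M.coupling D M.b j).amp i V hs gs τ
      = (M.coupling D M.b j).wordLin V hs gs ((τ.map M.formalH).prod i j) := by
  induction τ generalizing i V hs gs with
  | nil =>
    have hj : (M.coupling D M.b j).j = j := rfl
    by_cases hij : i = j
    · subst hij
      simp [Coupling.amp, hj, MonoidAlgebra.one_def, Coupling.wordLin_single, Coupling.wordAmp]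
    · simp [Coupling.amp, hij, hj]
  | cons s τ ih =>
    rw [List.map_cons, List.prod_cons]
    fin_cases i
    · simp only [Fin.zero_eta, formalH, interaction_mul_zero, Coupling.wordLin_cre_mul,
        Coupling.amp, ih]
    · simp only [Fin.mk_one, formalH, interaction_mul_one, map_add, map_smul, smul_eq_mul,
        Coupling.wordLin_ann_mul, Coupling.amp, ih]
      rw [add_comm]
      rfl

lemma matrixElement_wickPoly (D : ℝ → ℂ) (b : ℂ) (j : Fin 2) (hs gs : List (OnePhoton μ))
    (x : FormalOp) :
    matrixElement hs gs (M.wickPoly D x) = (M.coupling D b j).wordLin [] hs gs x := by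
  rw [← wickLin_apply, ← matrixElementLin_apply]
  induction x using MonoidAlgebra.induction_linear with
  | zero => simp
  | add x y hx hy => simp only [map_add, hx, hy]
  | single w r =>
    have : M.wickLin D (MonoidAlgebra.single w r) = r • M.wick D w.toList := by
      change (Finsupp.lsum ℂ fun w : FreeMonoid Letter =>
        (LinearMap.id.smulRight (M.wick D w.toList) : ℂ →ₗ[ℂ] FieldOp μ)) (Finsupp.single w r) = _
      simp
    rw [this, map_smul, matrixElementLin_apply, M.matrixElement_wick D b j,
      Coupling.wordLin_single, smul_eq_mul]

lemma matrixElement_wickPoly_prod (D : ℝ → ℂ) (i j : Fin 2) (hs gs : List (OnePhoton μ)) {n : ℕ}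
    (τ : Fin n → ℝ) :
    matrixElement hs gs (M.wickPoly D ((List.ofFn fun k => M.formalH (τ k)).prod i j))
      = (M.coupling D M.b j).amp i [] hs gs (List.ofFn τ) := by
  rw [amp_eq_wordLin, ← M.matrixElement_wickPoly, List.map_ofFn]
  rfl

/-- The substitution of the operators `A(t)`, `A'(t)` for the letters. -/
noncomputable def evalOp : FormalOp →ₐ[ℂ] FieldOp μ :=
  MonoidAlgebra.lift ℂ _ _ (FreeMonoid.lift fun x => match x with
    | Letter.ann s => M.A s
    | Letter.cre s => M.A' s)

lemma evalOp_eq_wickPoly (hFr : ∀ s r, inner ℂ (M.annVec s) (M.creVec r) = M.Fr (s - r))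
    (x : FormalOp) : M.evalOp x = M.wickPoly M.Fr x := by
  rw [evalOp, MonoidAlgebra.lift_apply, wickPoly]
  refine Finsupp.sum_congr fun w _ => ?_
  rw [← M.wordOp_eq_wick hFr, FreeMonoid.lift_apply]
  rfl

lemma evalOp_formalH (t : ℝ) : M.evalOp.mapMatrix (M.formalH t) = M.H t := by
  rw [formalH, interaction_map, H]
  simp [evalOp]

lemma evalOp_prod (i j : Fin 2) (τ : List ℝ) :
    M.evalOp ((τ.map M.formalH).prod i j) = (τ.map M.H).prod i j := by
  have : M.evalOp.mapMatrix (τ.map M.formalH).prod = (τ.map M.H).prod := by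
    rw [map_list_prod, List.map_map]
    congr 2
    funext s
    exact M.evalOp_formalH s
  rw [← this]
  rfl

/-- With the true commutator function, normal ordering does not change the operator, so the
propagators are covered by the analysis of the replaced series. -/
lemma propagatorTerm_eq (hFr : ∀ s r, inner ℂ (M.annVec s) (M.creVec r) = M.Fr (s - r))
    (hs gs : List (OnePhoton μ)) (t : ℝ) (i j : Fin 2) :
    M.propagatorTerm hs gs t i j = M.replacedTerm M.Fr hs gs t i j := by
  funext n
  unfold propagatorTerm replacedTerm dysonTerm
  congr 2
  funext τ
  change _ = matrixElement hs gs (M.wickPoly M.Fr _)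
  rw [← M.evalOp_eq_wickPoly hFr]
  have h₁ : (List.ofFn fun k => M.H (τ k)) = (List.ofFn τ).map M.H := by rw [List.map_ofFn]; rfl
  have h₂ : (List.ofFn fun k => M.formalH (τ k)) = (List.ofFn τ).map M.formalH := by
    rw [List.map_ofFn]; rfl
  rw [h₁, h₂, evalOp_prod]

lemma replacedTerm_eq (D : ℝ → ℂ) (hs gs : List (OnePhoton μ)) (t : ℝ) (i j : Fin 2) (n : ℕ) :
    M.replacedTerm D hs gs t i j n = (-Complex.I) ^ n * simplexIntegral n t fun τ =>
      (M.coupling D M.b j).amp i [] hs gs (List.ofFn τ) := by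
  simp only [replacedTerm, dysonTerm, matrixElement_wickPoly_prod]

end Model

/-! ### The normally ordered series as the contraction-free Dyson series -/

namespace Coupling

variable {α β : Type*} (P : Coupling α β)

/-- The term of order `n` of the Dyson series with integrand `amp`. -/
noncomputable def term (n : ℕ) (i : Fin 2) (t : ℝ) (V : List ℝ) (hs : List α) (gs : List β) : ℂ :=
  (-Complex.I) ^ n * simplexIntegral n t fun τ => P.amp i V hs gs (List.ofFn τ)

/-- The coupling without contractions and without the renormalization term. -/
def free : Coupling α β := { P with D := 0, b := 0 }

@[simp] lemma free_D : P.free.D = 0 := rfl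

@[simp] lemma free_b : P.free.b = 0 := rfl

/-- When `D = 0` a pending contraction can never be closed, and the recursion ends with zero unless
none is pending. -/
lemma free_amp_of_ne_nil (τ : List ℝ) (i : Fin 2) {V : List ℝ} (hV : V ≠ []) (hs : List α)
    (gs : List β) : P.free.amp i V hs gs τ = 0 := by
  induction τ generalizing i V hs gs with
  | nil => simp [amp, hV]
  | cons s τ ih =>
    fin_cases i
    · simp [amp, ih, hV]
    · simp [amp, ih, hV]

lemma free_amp_zero (s : ℝ) (τ : List ℝ) (hs : List α) (gs : List β) :
    P.free.amp 0 [] hs gs (s :: τ)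
      = eraseSum hs fun h hs' => P.w h s * P.free.amp 1 [] hs' gs τ := by
  simp [amp, free]

lemma free_amp_one (s : ℝ) (τ : List ℝ) (hs : List α) (gs : List β) :
    P.free.amp 1 [] hs gs (s :: τ)
      = eraseSum gs fun g gs' => P.u g s * P.free.amp 0 [] hs gs' τ := by
  rw [amp, P.free_amp_of_ne_nil τ 0 (List.cons_ne_nil _ _)]
  simp [free]

/-- Without the term `b` every factor of the Hamiltonian flips the atomic state, so the number of
factors has the parity of the total change. -/
lemma free_amp_parity (τ : List ℝ) (i : Fin 2) (hs : List α) (gs : List β)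
    (h : Odd (i.val + P.j.val + τ.length)) : P.free.amp i [] hs gs τ = 0 := by
  induction τ generalizing i hs gs with
  | nil =>
    have : i ≠ P.j := by
      rintro rfl
      simp [Nat.odd_iff] at h
      omega
    simp [amp, free, this]
  | cons s τ ih =>
    have hj : ∀ k : Fin 2, k.val = 1 - i.val → ∀ hs gs, P.free.amp k [] hs gs τ = 0 := by
      intro k hk hs gs
      refine ih k hs gs ?_
      have := i.isLt
      rw [Nat.odd_iff] at h ⊢
      simp only [List.length_cons] at h
      omega
    fin_cases i
    · simp [free_amp_zero, hj 1 rfl]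
    · simp [free_amp_one, hj 0 rfl]

lemma simplexIntegral_zero (n : ℕ) (t : ℝ) : simplexIntegral n t (fun _ => 0) = 0 := by
  induction n generalizing t with
  | zero => rfl
  | succ n ih => simp [simplexIntegral, ih]

lemma free_term_parity (n : ℕ) (i : Fin 2) (t : ℝ) (hs : List α) (gs : List β)
    (h : Odd (i.val + P.j.val + n)) : P.free.term n i t [] hs gs = 0 := by
  have : ∀ τ : Fin n → ℝ, P.free.amp i [] hs gs (List.ofFn τ) = 0 := fun τ =>
    P.free_amp_parity _ i hs gs (by simpa using h)
  simp [term, this, simplexIntegral_zero]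

end Coupling

namespace Model

variable {K : Type*} [MeasurableSpace K] {μ : Measure K} (M : Model μ)

lemma A_commute_prod (s : ℝ) {n : ℕ} (τ : Fin n → ℝ) :
    Commute (M.A s) (List.ofFn fun k => M.A (τ k)).prod := by
  refine Commute.list_prod_right _ _ fun x hx => ?_
  obtain ⟨k, rfl⟩ := (List.mem_ofFn' _ _).1 hx
  exact annihilate_comm _ _

/-- The annihilators commute, so `A(t₁)` may be moved to the far right. The two latest times are
then the outermost operators, which is the form in which matrix elements delete particles. -/
lemma normal11_succ (n : ℕ) (τ : Fin (2 * (n + 1)) → ℝ) :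
    M.normal11 (n + 1) τ
      = M.A' (τ ⟨1, by omega⟩) * (M.normal11 n fun k => τ k.succ.succ) * M.A (τ 0) := by
  rw [normal11, List.ofFn_succ, List.ofFn_succ, List.prod_cons, List.prod_cons,
    (M.A_commute_prod _ _).eq]
  simp only [normal11, mul_assoc]
  rfl

lemma normal00_succ (n : ℕ) (τ : Fin (2 * (n + 1)) → ℝ) :
    M.normal00 (n + 1) τ
      = M.A' (τ 0) * (M.normal00 n fun k => τ k.succ.succ) * M.A (τ ⟨1, by omega⟩) := by
  rw [normal00, List.ofFn_succ, List.ofFn_succ, List.prod_cons, List.prod_cons,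
    (M.A_commute_prod _ _).eq]
  simp only [normal00, mul_assoc]
  rfl

lemma normal01_eq (n : ℕ) (τ : Fin (2 * n + 1) → ℝ) :
    M.normal01 n τ = M.A' (τ 0) * M.normal11 n fun k => τ k.succ := by
  rw [normal01, List.ofFn_succ, List.prod_cons, mul_assoc]
  rfl

lemma normal10_eq (n : ℕ) (τ : Fin (2 * n + 1) → ℝ) :
    M.normal10 n τ = (M.normal00 n fun k => τ k.succ) * M.A (τ 0) := by
  rw [normal10, List.ofFn_succ, List.prod_cons, (M.A_commute_prod _ _).eq, ← mul_assoc]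
  rfl

lemma matrixElement_normal11 (n : ℕ) (hs gs : List (OnePhoton μ)) (τ : Fin (2 * n) → ℝ) :
    matrixElement hs gs (M.normal11 n τ)
      = (M.coupling 0 0 1).free.amp 1 [] hs gs (List.ofFn τ) := by
  induction n generalizing hs gs with
  | zero => simp [normal11, Coupling.amp, coupling, Coupling.free]
  | succ n ih =>
    have h : List.ofFn τ = τ 0 :: τ ⟨1, by omega⟩ :: List.ofFn fun k : Fin (2 * n) =>
        τ k.succ.succ := by
      exact (List.ofFn_succ).trans (congrArg _ List.ofFn_succ)
    rw [h, Coupling.free_amp_one, normal11_succ, A_eq, matrixElement_mul_annihilate]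
    simp only [Coupling.free_amp_zero, A'_eq, matrixElement_create_mul, ih]
    rfl

lemma matrixElement_normal00 (n : ℕ) (hs gs : List (OnePhoton μ)) (τ : Fin (2 * n) → ℝ) :
    matrixElement hs gs (M.normal00 n τ)
      = (M.coupling 0 0 0).free.amp 0 [] hs gs (List.ofFn τ) := by
  induction n generalizing hs gs with
  | zero => simp [normal00, Coupling.amp, coupling, Coupling.free]
  | succ n ih =>
    have h : List.ofFn τ = τ 0 :: τ ⟨1, by omega⟩ :: List.ofFn fun k : Fin (2 * n) =>
        τ k.succ.succ := by
      exact (List.ofFn_succ).trans (congrArg _ List.ofFn_succ)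
    rw [h, Coupling.free_amp_zero, normal00_succ, A'_eq, mul_assoc, matrixElement_create_mul]
    simp only [Coupling.free_amp_one, A_eq, matrixElement_mul_annihilate, ih]
    rfl

lemma matrixElement_normal01 (n : ℕ) (hs gs : List (OnePhoton μ)) (τ : Fin (2 * n + 1) → ℝ) :
    matrixElement hs gs (M.normal01 n τ)
      = (M.coupling 0 0 1).free.amp 0 [] hs gs (List.ofFn τ) := by
  rw [normal01_eq, A'_eq, matrixElement_create_mul, List.ofFn_succ, Coupling.free_amp_zero]
  simp only [matrixElement_normal11]
  rfl

lemma matrixElement_normal10 (n : ℕ) (hs gs : List (OnePhoton μ)) (τ : Fin (2 * n + 1) → ℝ) :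
    matrixElement hs gs (M.normal10 n τ)
      = (M.coupling 0 0 0).free.amp 1 [] hs gs (List.ofFn τ) := by
  rw [normal10_eq, A_eq, matrixElement_mul_annihilate, List.ofFn_succ, Coupling.free_amp_one]
  simp only [matrixElement_normal00]
  rfl

/-- The free Dyson series retains only alternating words; the order `2 * n + (if i = j then 0 else
1)` translates the two indexings of the `N`-series. -/
lemma normalTerm_eq (D : ℝ → ℂ) (b : ℂ) (hs gs : List (OnePhoton μ)) (t : ℝ) (i j : Fin 2) (n : ℕ) :
    M.normalTerm hs gs t i j n
      = (M.coupling D b j).free.term (2 * n + (if i = j then 0 else 1)) i t [] hs gs := by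
  have hf : (M.coupling D b j).free = (M.coupling 0 0 j).free := rfl
  rw [hf]
  fin_cases i <;> fin_cases j
  · simp only [Fin.zero_eta, normalTerm, matrixElement_normal00]; rfl
  · simp only [Fin.zero_eta, Fin.mk_one, normalTerm, matrixElement_normal01]; rfl
  · simp only [Fin.zero_eta, Fin.mk_one, normalTerm, matrixElement_normal10]; rfl
  · simp only [Fin.mk_one, normalTerm, matrixElement_normal11]; rfl

lemma support_free_term_subset (D : ℝ → ℂ) (b : ℂ) (hs gs : List (OnePhoton μ)) (t : ℝ)
    (i j : Fin 2) :
    Function.support (fun n => (M.coupling D b j).free.term n i t [] hs gs)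
      ⊆ Set.range fun n => 2 * n + (if i = j then 0 else 1) := by
  intro n hn
  by_contra hr
  refine hn (Coupling.free_term_parity _ n i t hs gs ?_)
  change Odd (i.val + j.val + n)
  rw [← Nat.not_even_iff_odd]
  refine fun he => hr ?_
  rw [Nat.even_iff] at he
  refine ⟨n / 2, ?_⟩
  have hi := i.isLt
  have hj := j.isLt
  dsimp only
  split_ifs with h
  · subst h; omega
  · rw [Fin.ext_iff] at h; omega

lemma injective_two_mul_add (c : ℕ) : Function.Injective fun n : ℕ => 2 * n + c := fun a b h => by
  dsimp only at h; omega

lemma summable_normalTerm_iff (D : ℝ → ℂ) (b : ℂ) (hs gs : List (OnePhoton μ)) (t : ℝ)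
    (i j : Fin 2) :
    Summable (M.normalTerm hs gs t i j)
      ↔ Summable fun n => (M.coupling D b j).free.term n i t [] hs gs := by
  rw [← (injective_two_mul_add (if i = j then 0 else 1)).summable_iff
    (f := fun n => (M.coupling D b j).free.term n i t [] hs gs) fun n hn => by
      by_contra h
      exact hn (M.support_free_term_subset D b hs gs t i j h)]
  exact iff_of_eq (congrArg (fun f => Summable f) (funext (M.normalTerm_eq D b hs gs t i j)))

lemma tsum_normalTerm (D : ℝ → ℂ) (b : ℂ) (hs gs : List (OnePhoton μ)) (t : ℝ) (i j : Fin 2) :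
    ∑' n, M.normalTerm hs gs t i j n
      = ∑' n, (M.coupling D b j).free.term n i t [] hs gs := by
  rw [← (injective_two_mul_add _).tsum_eq (M.support_free_term_subset D b hs gs t i j)]
  exact tsum_congr (M.normalTerm_eq D b hs gs t i j)

end Model

/-! ### Continuity and linearity of time-ordered integrals -/

/-- The outermost time variable is absorbed into the parameter space, which is why the induction
runs over all `X` and the upper limit is itself a function of the parameter. -/
lemma continuous_simplexIntegral (n : ℕ) {X : Type} [TopologicalSpace X]
    [FirstCountableTopology X] [LocallyCompactSpace X] {G : X → (Fin n → ℝ) → ℂ}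
    (hG : Continuous fun p : X × (Fin n → ℝ) => G p.1 p.2) {T : X → ℝ} (hT : Continuous T) :
    Continuous fun x => simplexIntegral n (T x) (G x) := by
  induction n generalizing X with
  | zero => exact hG.comp (continuous_id.prodMk continuous_const)
  | succ n ih =>
    simp only [simplexIntegral]
    refine intervalIntegral.continuous_parametric_intervalIntegral_of_continuous
      (f := fun x s => simplexIntegral n s fun τ => G x (Fin.cons s τ)) ?_ hT
    refine ih (X := X × ℝ) (G := fun p τ => G p.1 (Fin.cons p.2 τ)) ?_ continuous_snd
    exact hG.comp (Continuous.prodMk (by fun_prop)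
      (Continuous.finCons (A := fun _ => ℝ) (by fun_prop) (by fun_prop)))

lemma continuous_simplexIntegral_cons {n : ℕ} {G : (Fin (n + 1) → ℝ) → ℂ} (hG : Continuous G) :
    Continuous fun s => simplexIntegral n s fun τ => G (Fin.cons s τ) := by
  refine continuous_simplexIntegral n (X := ℝ) (G := fun s τ => G (Fin.cons s τ)) ?_ continuous_id
  exact hG.comp (Continuous.finCons (A := fun _ => ℝ) (by fun_prop) (by fun_prop))

lemma continuous_comp_cons {n : ℕ} {G : (Fin (n + 1) → ℝ) → ℂ} (hG : Continuous G) (s : ℝ) :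
    Continuous fun τ : Fin n → ℝ => G (Fin.cons s τ) := by
  exact hG.comp (Continuous.finCons (A := fun _ => ℝ) (by fun_prop) (by fun_prop))

lemma simplexIntegral_add {n : ℕ} (t : ℝ) {F G : (Fin n → ℝ) → ℂ} (hF : Continuous F)
    (hG : Continuous G) :
    simplexIntegral n t (fun τ => F τ + G τ)
      = simplexIntegral n t F + simplexIntegral n t G := by
  induction n generalizing t with
  | zero => rfl
  | succ n ih =>
    simp only [simplexIntegral]
    rw [← intervalIntegral.integral_add
      ((continuous_simplexIntegral_cons hF).intervalIntegrable _ _)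
      ((continuous_simplexIntegral_cons hG).intervalIntegrable _ _)]
    exact intervalIntegral.integral_congr fun s _ =>
      ih s (continuous_comp_cons hF s) (continuous_comp_cons hG s)

lemma simplexIntegral_const_mul {n : ℕ} (t : ℝ) (c : ℂ) (G : (Fin n → ℝ) → ℂ) :
    simplexIntegral n t (fun τ => c * G τ) = c * simplexIntegral n t G := by
  induction n generalizing t with
  | zero => rfl
  | succ n ih => simp only [simplexIntegral, ih, intervalIntegral.integral_const_mul]

lemma simplexIntegral_sum {n : ℕ} (t : ℝ) {ι : Type*} (S : Finset ι) {F : ι → (Fin n → ℝ) → ℂ}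
    (hF : ∀ k, Continuous (F k)) :
    simplexIntegral n t (fun τ => ∑ k ∈ S, F k τ) = ∑ k ∈ S, simplexIntegral n t (F k) := by
  classical
  induction S using Finset.induction_on with
  | empty =>
    simpa using simplexIntegral_const_mul t 0 (fun _ : Fin n → ℝ => 0)
  | insert k S hk ih =>
    simp only [Finset.sum_insert hk]
    rw [simplexIntegral_add t (hF k) (by fun_prop), ih]

lemma simplexIntegral_eraseSum {n : ℕ} (t : ℝ) {α : Type*} (l : List α)
    {F : α → List α → (Fin n → ℝ) → ℂ} (hF : ∀ x l', Continuous (F x l')) :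
    simplexIntegral n t (fun τ => eraseSum l fun x l' => F x l' τ)
      = eraseSum l fun x l' => simplexIntegral n t (F x l') :=
  simplexIntegral_sum t _ fun _ => hF _ _

lemma continuous_eraseSum {X α : Type*} [TopologicalSpace X] {l : List α}
    {F : α → List α → X → ℂ}
    (hF : ∀ x ∈ l, ∀ l', l'.Sublist l → Continuous (F x l')) :
    Continuous fun y => eraseSum l fun x l' => F x l' y :=
  continuous_finsetSum _ fun _ _ => hF _ (List.getElem_mem _) _ (List.eraseIdx_sublist _ _)

/-! ### Volterra recursions for the terms of the series -/

namespace Coupling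

variable {α β : Type*} (P : Coupling α β)

/-- The functions of time in a coupling are continuous. -/
structure IsContinuous : Prop where
  w : ∀ h, Continuous (P.w h)
  u : ∀ g, Continuous (P.u g)
  D : Continuous P.D

variable {P}

lemma IsContinuous.free (hP : P.IsContinuous) : P.free.IsContinuous :=
  ⟨hP.w, hP.u, continuous_const⟩

lemma IsContinuous.amp (hP : P.IsContinuous) {X : Type} [TopologicalSpace X] (i : Fin 2)
    (V : List (X → ℝ)) (hV : ∀ v ∈ V, Continuous v) (hs : List α) (gs : List β)
    (τ : List (X → ℝ)) (hτ : ∀ s ∈ τ, Continuous s) :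
    Continuous fun x => P.amp i (V.map fun v => v x) hs gs (τ.map fun s => s x) := by
  induction τ generalizing i V hs gs with
  | nil =>
    simp only [List.map_nil, Coupling.amp, List.map_eq_nil_iff]
    exact continuous_const
  | cons s τ ih =>
    have hsc : Continuous s := hτ s (by simp)
    replace ih := fun i V hV hs gs => ih i V hV hs gs fun r hr => hτ r (by simp [hr])
    fin_cases i
    · simp only [List.map_cons, Fin.zero_eta, Coupling.amp, eraseSum_map]
      refine .add (continuous_eraseSum fun h _ hs' _ => ?_)
        (continuous_eraseSum fun v hv V' hV' => ?_)
      · exact ((hP.w h).comp hsc).mul (ih 1 V hV hs' gs)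
      · exact (hP.D.comp ((hV v hv).sub hsc)).mul
          (ih 1 V' (fun v' hv' => hV v' (hV'.subset hv')) hs gs)
    · simp only [List.map_cons, Fin.mk_one, Coupling.amp]
      refine .add (continuous_const.mul (ih 1 V hV hs gs))
        (.add (continuous_eraseSum fun g _ gs' _ => ?_) ?_)
      · exact ((hP.u g).comp hsc).mul (ih 0 V hV hs gs')
      · refine ih 0 (s :: V) ?_ hs gs
        simpa using ⟨hsc, hV⟩

lemma IsContinuous.amp_ofFn (hP : P.IsContinuous) {n : ℕ} (i : Fin 2) (V : List ℝ) (hs : List α)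
    (gs : List β) : Continuous fun τ : Fin n → ℝ => P.amp i V hs gs (List.ofFn τ) := by
  have := hP.amp (X := Fin n → ℝ) i (V.map fun v _ => v) (by simp [continuous_const]) hs gs
    (List.ofFn fun k τ => τ k) (by
      intro s hs
      obtain ⟨k, rfl⟩ := (List.mem_ofFn' _ _).1 hs
      exact continuous_apply k)
  simpa [List.map_ofFn, Function.comp_def] using this

lemma IsContinuous.term (hP : P.IsContinuous) (n : ℕ) {X : Type} [TopologicalSpace X]
    [FirstCountableTopology X] [LocallyCompactSpace X] (i : Fin 2) {t : X → ℝ} (ht : Continuous t)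
    (V : List (X → ℝ)) (hV : ∀ v ∈ V, Continuous v) (hs : List α) (gs : List β) :
    Continuous fun x => P.term n i (t x) (V.map fun v => v x) hs gs := by
  refine continuous_const.mul (continuous_simplexIntegral n
    (G := fun x τ => P.amp i (V.map fun v => v x) hs gs (List.ofFn τ)) ?_ ht)
  have := hP.amp (X := X × (Fin n → ℝ)) i (V.map fun v p => v p.1) (by
      simpa using fun v hv => (hV v hv).fst') hs gs
    (List.ofFn fun k p => p.2 k) (by
      intro s hs
      obtain ⟨k, rfl⟩ := (List.mem_ofFn' _ _).1 hs
      exact (continuous_apply k).comp continuous_snd)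
  simpa [List.map_ofFn, Function.comp_def] using this

lemma IsContinuous.term_const (hP : P.IsContinuous) (n : ℕ) (i : Fin 2) (V : List ℝ) (hs : List α)
    (gs : List β) : Continuous fun t => P.term n i t V hs gs := by
  simpa [Function.comp_def] using hP.term n (X := ℝ) i continuous_id (V.map fun v _ => v)
    (by simp [continuous_const]) hs gs

lemma IsContinuous.term_cons (hP : P.IsContinuous) (n : ℕ) (i : Fin 2) (V : List ℝ) (hs : List α)
    (gs : List β) : Continuous fun t => P.term n i t (t :: V) hs gs := by
  simpa [Function.comp_def] using hP.term n (X := ℝ) i continuous_id (id :: V.map fun v _ => v)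
    (by simp [continuous_const, continuous_id]) hs gs

lemma IsContinuous.term_singleton (hP : P.IsContinuous) (n : ℕ) (i : Fin 2) (hs : List α)
    (gs : List β) : Continuous fun p : ℝ × ℝ => P.term n i p.2 [p.1] hs gs := by
  simpa using hP.term n (X := ℝ × ℝ) i continuous_snd [Prod.fst]
    (by simp [continuous_fst]) hs gs

lemma term_zero (i : Fin 2) (t : ℝ) (V : List ℝ) (hs : List α) (gs : List β) :
    P.term 0 i t V hs gs = if i = P.j ∧ V = [] then P.c hs gs else 0 := by
  simp [Coupling.term, simplexIntegral, Coupling.amp]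

lemma term_succ_zero (hP : P.IsContinuous) (n : ℕ) (t : ℝ) (V : List ℝ) (hs : List α)
    (gs : List β) :
    P.term (n + 1) 0 t V hs gs = ∫ s in (0 : ℝ)..t, -Complex.I *
      ((eraseSum hs fun h hs' => P.w h s * P.term n 1 s V hs' gs)
        + eraseSum V fun v V' => P.D (v - s) * P.term n 1 s V' hs gs) := by
  have hc := fun (V : List ℝ) (hs : List α) => hP.amp_ofFn (n := n) 1 V hs gs
  simp only [Coupling.term, simplexIntegral, ← intervalIntegral.integral_const_mul]
  refine intervalIntegral.integral_congr fun s _ => ?_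
  simp only [List.ofFn_cons, Coupling.amp]
  rw [simplexIntegral_add, simplexIntegral_eraseSum, simplexIntegral_eraseSum]
  · simp only [simplexIntegral_const_mul, mul_add, mul_eraseSum, pow_succ]
    congr 1 <;> exact eraseSum_congr fun _ _ _ _ => by ring
  · exact fun _ _ => continuous_const.mul (hc _ _)
  · exact fun _ _ => continuous_const.mul (hc _ _)
  · exact continuous_eraseSum fun _ _ _ _ => continuous_const.mul (hc _ _)
  · exact continuous_eraseSum fun _ _ _ _ => continuous_const.mul (hc _ _)

lemma term_succ_one (hP : P.IsContinuous) (n : ℕ) (t : ℝ) (V : List ℝ) (hs : List α)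
    (gs : List β) :
    P.term (n + 1) 1 t V hs gs = ∫ s in (0 : ℝ)..t, (P.b * P.term n 1 s V hs gs
      + -Complex.I * ((eraseSum gs fun g gs' => P.u g s * P.term n 0 s V hs gs')
        + P.term n 0 s (s :: V) hs gs)) := by
  have hc := fun (i : Fin 2) (V : List ℝ) (gs : List β) => hP.amp_ofFn (n := n) i V hs gs
  simp only [Coupling.term, simplexIntegral, ← intervalIntegral.integral_const_mul]
  refine intervalIntegral.integral_congr fun s _ => ?_
  have hsum : Continuous fun τ : Fin n → ℝ =>
      eraseSum gs fun g gs' => P.u g s * P.amp 0 V hs gs' (List.ofFn τ) :=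
    continuous_eraseSum fun _ _ _ _ => continuous_const.mul (hc _ _ _)
  simp only [List.ofFn_cons, Coupling.amp]
  rw [simplexIntegral_add (F := fun τ => Complex.I * P.b * P.amp 1 V hs gs (List.ofFn τ)) s
      (continuous_const.mul (hc _ _ _)) (hsum.fun_add (hc _ _ _)),
    simplexIntegral_add s hsum (hc _ _ _), simplexIntegral_eraseSum]
  · simp only [simplexIntegral_const_mul, mul_add, mul_eraseSum, pow_succ]
    congr 1
    -- This is `(-i)(ib) = b`: the renormalization term enters the recursion with a positive sign.
    · linear_combination (-(-Complex.I) ^ n * P.b *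
        simplexIntegral n s fun τ => P.amp 1 V hs gs (List.ofFn τ)) * Complex.I_mul_I
    · congr 1
      · exact eraseSum_congr fun _ _ _ _ => by ring
      · ring
  · exact fun _ _ => continuous_const.mul (hc _ _ _)

end Coupling

/-! ### Absolute convergence by a majorant -/

lemma sum_norm_integral_le {f : ℕ → ℝ → ℂ} (hf : ∀ n, Continuous (f n)) {F F' : ℝ → ℝ}
    (hF : ∀ s, HasDerivAt F (F' s) s) (hF' : Continuous F') {t : ℝ} (ht : 0 ≤ t) (N : ℕ)
    (h : ∀ s ∈ Set.Icc 0 t, ∑ n ∈ Finset.range N, ‖f n s‖ ≤ F' s) :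
    ∑ n ∈ Finset.range N, ‖∫ s in (0 : ℝ)..t, f n s‖ ≤ F t - F 0 := by
  calc ∑ n ∈ Finset.range N, ‖∫ s in (0 : ℝ)..t, f n s‖
      ≤ ∑ n ∈ Finset.range N, ∫ s in (0 : ℝ)..t, ‖f n s‖ :=
        Finset.sum_le_sum fun n _ => intervalIntegral.norm_integral_le_integral_norm ht
    _ = ∫ s in (0 : ℝ)..t, ∑ n ∈ Finset.range N, ‖f n s‖ :=
        (intervalIntegral.integral_finsetSum fun n _ =>
          (hf n).norm.intervalIntegrable _ _).symm
    _ ≤ ∫ s in (0 : ℝ)..t, F' s :=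
        intervalIntegral.integral_mono_on ht
          ((continuous_finsetSum _ fun n _ => (hf n).norm).intervalIntegrable _ _)
          (hF'.intervalIntegrable _ _) h
    _ = F t - F 0 :=
        intervalIntegral.integral_eq_sub_of_hasDerivAt (fun s _ => hF s)
          (hF'.intervalIntegrable _ _)

lemma sum_map_le_of_sublist {α : Type*} {l l' : List α} (h : l'.Sublist l) {f : α → ℝ}
    (hf : ∀ x, 0 ≤ f x) : (l'.map f).sum ≤ (l.map f).sum :=
  (h.map f).sum_le_sum (by simpa using fun x _ => hf x)

namespace Coupling

variable {α β : Type*} (P : Coupling α β)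

/-- The product over `v ∈ V` of the `L¹` norms on `[0, t]` of the functions `r ↦ D (v - r)`. -/
noncomputable def contractionBound (V : List ℝ) (t : ℝ) : ℝ :=
  (V.map fun v => ∫ r in (0 : ℝ)..t, ‖P.D (v - r)‖).prod

/-- The sum of the absolute values of the pairings of the particles in `hs` and `gs`. -/
noncomputable def pairingNorm (hs : List α) (gs : List β) (s : ℝ) : ℝ :=
  (hs.map fun h => ‖P.w h s‖).sum + (gs.map fun g => ‖P.u g s‖).sum

/-- A solution of the linear differential inequality satisfied by the sums of the absolute values of
the terms. -/
noncomputable def majorant (K C : ℝ) (hs : List α) (gs : List β) (t : ℝ) : ℝ :=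
  K * Real.exp (∫ s in (0 : ℝ)..t, (‖P.b‖ + C + P.pairingNorm hs gs s))

variable {P}

lemma pairingNorm_nonneg (hs : List α) (gs : List β) (s : ℝ) : 0 ≤ P.pairingNorm hs gs s := by
  refine add_nonneg (List.sum_nonneg ?_) (List.sum_nonneg ?_) <;> simp

lemma IsContinuous.pairingNorm (hP : P.IsContinuous) (hs : List α) (gs : List β) :
    Continuous (P.pairingNorm hs gs) := by
  unfold Coupling.pairingNorm
  simp only [← eraseSum_const]
  exact .add (continuous_finsetSum _ fun _ _ => (hP.w _).norm)
    (continuous_finsetSum _ fun _ _ => (hP.u _).norm)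

lemma majorant_nonneg {K : ℝ} (hK : 0 ≤ K) (C : ℝ) (hs : List α) (gs : List β) (t : ℝ) :
    0 ≤ P.majorant K C hs gs t :=
  mul_nonneg hK (Real.exp_pos _).le

lemma majorant_hasDerivAt (hP : P.IsContinuous) (K C : ℝ) (hs : List α) (gs : List β) (t : ℝ) :
    HasDerivAt (P.majorant K C hs gs)
      ((‖P.b‖ + C + P.pairingNorm hs gs t) * P.majorant K C hs gs t) t := by
  have hc : Continuous fun s => ‖P.b‖ + C + P.pairingNorm hs gs s :=
    continuous_const.add (hP.pairingNorm hs gs)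
  have := ((hc.integral_hasStrictDerivAt 0 t).hasDerivAt.exp).const_mul K
  refine this.congr_deriv ?_
  unfold majorant
  ring

lemma contractionBound_nonneg (V : List ℝ) {t : ℝ} (ht : 0 ≤ t) : 0 ≤ P.contractionBound V t := by
  refine List.prod_nonneg ?_
  simpa using fun v _ => intervalIntegral.integral_nonneg ht fun r _ => norm_nonneg _

/-- The product rule, deleting one factor at a time, has exactly the shape of the closing of one
pending contraction in `term_succ_zero`. -/
lemma contractionBound_hasDerivAt (hP : P.IsContinuous) (V : List ℝ) (t : ℝ) :
    HasDerivAt (P.contractionBound V)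
      (eraseSum V fun v V' => ‖P.D (v - t)‖ * P.contractionBound V' t) t := by
  induction V with
  | nil =>
    have h : P.contractionBound [] = fun _ => 1 := by funext t; simp [contractionBound]
    rw [h, eraseSum_nil]
    exact hasDerivAt_const t 1
  | cons v V ih =>
    have hD := hP.D
    have hc : Continuous fun r => ‖P.D (v - r)‖ := by fun_prop
    have h := (hc.integral_hasStrictDerivAt 0 t).hasDerivAt.mul ih
    have hcons : ∀ V t, P.contractionBound (v :: V) t
        = (∫ r in (0 : ℝ)..t, ‖P.D (v - r)‖) * P.contractionBound V t := fun V t => by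
      simp [contractionBound]
    rw [show P.contractionBound (v :: V) = (fun u => ∫ r in (0 : ℝ)..u, ‖P.D (v - r)‖)
      * P.contractionBound V from funext (hcons V)]
    refine h.congr_deriv ?_
    simp only [eraseSum_cons, hcons, mul_eraseSum, mul_left_comm]

lemma contractionBound_continuous (hP : P.IsContinuous) (V : List ℝ) :
    Continuous (P.contractionBound V) :=
  continuous_iff_continuousAt.2 fun t => (contractionBound_hasDerivAt hP V t).continuousAt

lemma integral_norm_D_sub_le (hP : P.IsContinuous) {C T s : ℝ}
    (hC : ∫ r in (0 : ℝ)..T, ‖P.D r‖ ≤ C) (hs : s ∈ Set.Icc 0 T) :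
    ∫ r in (0 : ℝ)..s, ‖P.D (s - r)‖ ≤ C := by
  rw [intervalIntegral.integral_comp_sub_left (fun r => ‖P.D r‖) s, sub_self, sub_zero]
  exact (intervalIntegral.integral_mono_interval le_rfl hs.1 hs.2
    (Eventually.of_forall fun _ => norm_nonneg _) (hP.D.norm.intervalIntegrable _ _)).trans hC

lemma sum_norm_eraseSum_le {γ : Type*} (l : List γ) (a : γ → ℂ) (x : ℕ → γ → List γ → ℂ) (N : ℕ) :
    ∑ n ∈ Finset.range N, ‖eraseSum l fun y l' => a y * x n y l'‖
      ≤ eraseSum l fun y l' => ‖a y‖ * ∑ n ∈ Finset.range N, ‖x n y l'‖ := by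
  refine (Finset.sum_le_sum fun n _ => norm_eraseSum_le _ _).trans (le_of_eq ?_)
  unfold eraseSum
  rw [Finset.sum_comm]
  simp only [norm_mul, Finset.mul_sum]

/-- The sums of the absolute values of the terms of the Dyson series are bounded, with a factor for
each pending contraction. -/
theorem sum_norm_term_le (hP : P.IsContinuous) {K C T : ℝ} (hK : 0 ≤ K)
    (hC : ∫ r in (0 : ℝ)..T, ‖P.D r‖ ≤ C) {hs₀ : List α} {gs₀ : List β}
    (hc : ∀ hs gs, hs.Sublist hs₀ → gs.Sublist gs₀ → ‖P.c hs gs‖ ≤ K)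
    (N : ℕ) (i : Fin 2) {t : ℝ} (ht : t ∈ Set.Icc 0 T) (V : List ℝ) {hs : List α} {gs : List β}
    (hhs : hs.Sublist hs₀) (hgs : gs.Sublist gs₀) :
    ∑ n ∈ Finset.range N, ‖P.term n i t V hs gs‖
      ≤ P.majorant K C hs₀ gs₀ t * P.contractionBound V t := by
  have hC0 : 0 ≤ C := le_trans
    (intervalIntegral.integral_nonneg (ht.1.trans ht.2) fun r _ => norm_nonneg _) hC
  induction N generalizing i t V hs gs with
  | zero =>
    simpa using mul_nonneg (majorant_nonneg hK C hs₀ gs₀ t) (contractionBound_nonneg V ht.1)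
  | succ N ih =>
    set E := P.majorant K C hs₀ gs₀ with hE
    set B := P.contractionBound V with hB
    set B' := fun t => eraseSum V fun v V' => ‖P.D (v - t)‖ * P.contractionBound V' t with hB'
    set rate := fun s => ‖P.b‖ + C + P.pairingNorm hs₀ gs₀ s with hrate
    have hEn : ∀ s, 0 ≤ E s := majorant_nonneg hK C hs₀ gs₀
    have hFd : ∀ s, HasDerivAt (fun s => E s * B s) (rate s * E s * B s + E s * B' s) s := fun s =>
      (majorant_hasDerivAt hP K C hs₀ gs₀ s).mul (contractionBound_hasDerivAt hP V s)
    have hEc : Continuous E := continuous_iff_continuousAt.2 fun s =>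
      (majorant_hasDerivAt hP K C hs₀ gs₀ s).continuousAt
    have hD := hP.D
    have hFc : Continuous fun s => rate s * E s * B s + E s * B' s := by
      refine .add (((continuous_const.add (hP.pairingNorm _ _)).mul hEc).mul
        (contractionBound_continuous hP V)) (hEc.mul (continuous_finsetSum _ fun _ _ => ?_))
      exact Continuous.mul (by fun_prop) (contractionBound_continuous hP _)
    -- The term of order zero uses up the initial value of the majorant; the higher orders then only
    -- have to fit into its increment.
    have hzero : ‖P.term 0 i t V hs gs‖ ≤ E 0 * B 0 := by
      have hE0 : E 0 = K := by simp [hE, majorant]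
      rw [term_zero, hE0]
      split_ifs with h
      · have hB0 : B 0 = 1 := by simp [hB, h.2, contractionBound]
        rw [hB0, mul_one]
        exact hc hs gs hhs hgs
      · simpa using mul_nonneg hK (contractionBound_nonneg V le_rfl)
    rw [Finset.sum_range_succ']
    suffices ∑ n ∈ Finset.range N, ‖P.term (n + 1) i t V hs gs‖ ≤ E t * B t - E 0 * B 0 by
      linarith
    have hIcc : ∀ s ∈ Set.Icc 0 t, s ∈ Set.Icc 0 T := fun s h => ⟨h.1, h.2.trans ht.2⟩
    have hBn : ∀ s ∈ Set.Icc 0 t, 0 ≤ B s := fun s h => contractionBound_nonneg V h.1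
    have hw : ∀ s, (hs.map fun h => ‖P.w h s‖).sum ≤ (hs₀.map fun h => ‖P.w h s‖).sum := fun s =>
      sum_map_le_of_sublist hhs fun _ => norm_nonneg _
    have hu : ∀ s, (gs.map fun g => ‖P.u g s‖).sum ≤ (gs₀.map fun g => ‖P.u g s‖).sum := fun s =>
      sum_map_le_of_sublist hgs fun _ => norm_nonneg _
    have hw0 : ∀ s, 0 ≤ (hs₀.map fun h => ‖P.w h s‖).sum := fun s => List.sum_nonneg (by simp)
    have hu0 : ∀ s, 0 ≤ (gs₀.map fun g => ‖P.u g s‖).sum := fun s => List.sum_nonneg (by simp)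
    fin_cases i
    · simp only [Fin.zero_eta, term_succ_zero hP]
      refine sum_norm_integral_le (F := fun s => E s * B s) (fun n => ?_) hFd hFc ht.1 N
        fun s hst => ?_
      · refine continuous_const.mul (.add (continuous_eraseSum fun _ _ _ _ => ?_)
          (continuous_eraseSum fun _ _ _ _ => ?_))
        · exact (hP.w _).mul (hP.term_const _ _ _ _ _)
        · exact Continuous.mul (by fun_prop) (hP.term_const _ _ _ _ _)
      · have h₁ : ∑ n ∈ Finset.range N, ‖eraseSum hs fun h hs' => P.w h s * P.term n 1 s V hs' gs‖
            ≤ (hs.map fun h => ‖P.w h s‖).sum * (E s * B s) := by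
          refine (sum_norm_eraseSum_le hs (fun h => P.w h s) _ N).trans ?_
          rw [← eraseSum_const, eraseSum_mul]
          exact eraseSum_le fun h _ hs' hhs' => mul_le_mul_of_nonneg_left
            (ih 1 (hIcc s hst) V (hhs'.trans hhs) hgs) (norm_nonneg _)
        -- Closing a contraction is paid for by the derivative of `contractionBound`.
        have h₂ : ∑ n ∈ Finset.range N,
              ‖eraseSum V fun v V' => P.D (v - s) * P.term n 1 s V' hs gs‖
            ≤ E s * B' s := by
          refine (sum_norm_eraseSum_le V (fun v => P.D (v - s)) _ N).trans ?_
          rw [hB', mul_eraseSum]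
          refine eraseSum_le fun v _ V' _ => ?_
          rw [mul_left_comm]
          exact mul_le_mul_of_nonneg_left (ih 1 (hIcc s hst) V' hhs hgs) (norm_nonneg _)
        have h₃ := mul_le_mul_of_nonneg_right (hw s) (mul_nonneg (hEn s) (hBn s hst))
        have h₄ := mul_nonneg (add_nonneg (add_nonneg (norm_nonneg P.b) hC0) (hu0 s))
          (mul_nonneg (hEn s) (hBn s hst))
        calc _ ≤ ∑ n ∈ Finset.range N,
              (‖eraseSum hs fun h hs' => P.w h s * P.term n 1 s V hs' gs‖
                + ‖eraseSum V fun v V' => P.D (v - s) * P.term n 1 s V' hs gs‖) := by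
              refine Finset.sum_le_sum fun n _ => ?_
              rw [norm_mul, norm_neg, Complex.norm_I, one_mul]
              exact norm_add_le _ _
          _ ≤ _ := by
              rw [Finset.sum_add_distrib]
              simp only [hrate, pairingNorm]
              linarith
    · simp only [Fin.mk_one, term_succ_one hP]
      refine sum_norm_integral_le (F := fun s => E s * B s) (fun n => ?_) hFd hFc ht.1 N
        fun s hst => ?_
      · refine .add (continuous_const.mul (hP.term_const _ _ _ _ _))
          (continuous_const.mul (.add (continuous_eraseSum fun _ _ _ _ => ?_)
            (hP.term_cons _ _ _ _ _)))
        exact (hP.u _).mul (hP.term_const _ _ _ _ _)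
      · have h₁ : ∑ n ∈ Finset.range N, ‖eraseSum gs fun g gs' => P.u g s * P.term n 0 s V hs gs'‖
            ≤ (gs.map fun g => ‖P.u g s‖).sum * (E s * B s) := by
          refine (sum_norm_eraseSum_le gs (fun g => P.u g s) _ N).trans ?_
          rw [← eraseSum_const, eraseSum_mul]
          exact eraseSum_le fun g _ gs' hgs' => mul_le_mul_of_nonneg_left
            (ih 0 (hIcc s hst) V hhs (hgs'.trans hgs)) (norm_nonneg _)
        -- Opening a contraction at time `s` adds the factor `∫₀ˢ |D(s - r)| dr ≤ C`, which is the
        -- summand `C` in the exponential rate.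
        have h₂ : ∑ n ∈ Finset.range N, ‖P.term n 0 s (s :: V) hs gs‖ ≤ C * (E s * B s) := by
          refine (ih 0 (hIcc s hst) (s :: V) hhs hgs).trans ?_
          have : P.contractionBound (s :: V) s = (∫ r in (0 : ℝ)..s, ‖P.D (s - r)‖) * B s := by
            simp [contractionBound, hB]
          rw [this, mul_left_comm]
          exact mul_le_mul_of_nonneg_right (integral_norm_D_sub_le hP hC (hIcc s hst))
            (mul_nonneg (hEn s) (hBn s hst))
        have h₃ := mul_le_mul_of_nonneg_right (hu s) (mul_nonneg (hEn s) (hBn s hst))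
        have h₄ := mul_nonneg (hw0 s) (mul_nonneg (hEn s) (hBn s hst))
        have h₅ := mul_le_mul_of_nonneg_left (ih 1 (hIcc s hst) V hhs hgs) (norm_nonneg P.b)
        have h₆ : 0 ≤ E s * B' s := by
          refine mul_nonneg (hEn s) (Finset.sum_nonneg fun _ _ => ?_)
          exact mul_nonneg (norm_nonneg _) (contractionBound_nonneg _ hst.1)
        calc _ ≤ ∑ n ∈ Finset.range N, (‖P.b‖ * ‖P.term n 1 s V hs gs‖
              + (‖eraseSum gs fun g gs' => P.u g s * P.term n 0 s V hs gs'‖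
                + ‖P.term n 0 s (s :: V) hs gs‖)) := by
              refine Finset.sum_le_sum fun n _ => (norm_add_le _ _).trans ?_
              rw [norm_mul, norm_mul, norm_neg, Complex.norm_I, one_mul]
              exact add_le_add le_rfl (norm_add_le _ _)
          _ ≤ _ := by
              rw [Finset.sum_add_distrib, Finset.sum_add_distrib, ← Finset.mul_sum]
              simp only [hrate, pairingNorm]
              linarith

end Coupling

/-! ### The defect and the cancellation of the renormalization term -/

lemma intervalIntegral_triangle_swap {g : ℝ → ℝ → ℂ} (hg : Continuous fun p : ℝ × ℝ => g p.1 p.2)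
    {t : ℝ} (ht : 0 ≤ t) :
    ∫ s in (0 : ℝ)..t, ∫ r in (0 : ℝ)..s, g s r = ∫ r in (0 : ℝ)..t, ∫ s in r..t, g s r := by
  set F : ℝ → ℝ → ℂ := fun s r => {p : ℝ × ℝ | p.2 < p.1}.indicator (fun p => g p.1 p.2) (s, r)
    with hF
  have hS : MeasurableSet {p : ℝ × ℝ | p.2 < p.1} := measurableSet_lt measurable_snd measurable_fst
  have hint : IntegrableOn (Function.uncurry F) (Set.uIoc 0 t ×ˢ Set.uIoc 0 t) := by
    have : IntegrableOn (fun p : ℝ × ℝ => g p.1 p.2) (Set.uIoc 0 t ×ˢ Set.uIoc 0 t) :=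
      (hg.continuousOn.integrableOn_compact (isCompact_uIcc.prod isCompact_uIcc)).mono_set
        (Set.prod_mono Set.uIoc_subset_uIcc Set.uIoc_subset_uIcc)
    exact this.indicator hS
  have h₁ : ∀ s ∈ Set.uIcc 0 t, ∫ r in (0 : ℝ)..s, g s r = ∫ r in (0 : ℝ)..t, F s r := by
    intro s hs
    rw [Set.uIcc_of_le ht] at hs
    rw [intervalIntegral.integral_of_le hs.1, intervalIntegral.integral_of_le ht]
    have : ∀ r, F s r = (Set.Iio s).indicator (g s) r := fun r => rfl
    simp only [this]
    rw [setIntegral_indicator measurableSet_Iio, integral_Ioc_eq_integral_Ioo]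
    congr 2
    ext r
    simp only [Set.mem_Ioo, Set.mem_inter_iff, Set.mem_Ioc, Set.mem_Iio]
    exact ⟨fun h => ⟨⟨h.1, h.2.le.trans hs.2⟩, h.2⟩, fun h => ⟨h.1.1, h.2⟩⟩
  have h₂ : ∀ r ∈ Set.uIcc 0 t, ∫ s in r..t, g s r = ∫ s in (0 : ℝ)..t, F s r := by
    intro r hr
    rw [Set.uIcc_of_le ht] at hr
    rw [intervalIntegral.integral_of_le hr.2, intervalIntegral.integral_of_le ht]
    have : ∀ s, F s r = (Set.Ioi r).indicator (fun s => g s r) s := fun s => rfl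
    simp only [this]
    rw [setIntegral_indicator measurableSet_Ioi, Set.Ioc_inter_Ioi, max_eq_right hr.1]
  rw [intervalIntegral.integral_congr h₁, intervalIntegral.integral_congr h₂,
    intervalIntegral_intervalIntegral_swap]
  exact hint

namespace Coupling

variable {α β : Type*} {P : Coupling α β}

/-- The partial sums of the Dyson series. -/
noncomputable def partialSum (P : Coupling α β) (N : ℕ) (i : Fin 2) (t : ℝ) (V : List ℝ)
    (hs : List α) (gs : List β) : ℂ :=
  ∑ n ∈ Finset.range N, P.term n i t V hs gs

lemma mul_partialSum_eraseSum {γ : Type*} (l : List γ) (a : γ → ℂ) (x : ℕ → γ → List γ → ℂ)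
    (N : ℕ) :
    ∑ n ∈ Finset.range N, (eraseSum l fun y l' => a y * x n y l')
      = eraseSum l fun y l' => a y * ∑ n ∈ Finset.range N, x n y l' := by
  unfold eraseSum
  rw [Finset.sum_comm]
  simp only [Finset.mul_sum]

lemma partialSum_succ_zero (hP : P.IsContinuous) (N : ℕ) (t : ℝ) (V : List ℝ) (hs : List α)
    (gs : List β) :
    P.partialSum (N + 1) 0 t V hs gs = P.term 0 0 t V hs gs + ∫ s in (0 : ℝ)..t, -Complex.I *
      ((eraseSum hs fun h hs' => P.w h s * P.partialSum N 1 s V hs' gs)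
        + eraseSum V fun v V' => P.D (v - s) * P.partialSum N 1 s V' hs gs) := by
  rw [partialSum, Finset.sum_range_succ', add_comm]
  congr 1
  have hD := hP.D
  simp only [term_succ_zero hP]
  rw [← intervalIntegral.integral_finsetSum]
  · refine intervalIntegral.integral_congr fun s _ => ?_
    simp only [← Finset.mul_sum, Finset.sum_add_distrib, mul_partialSum_eraseSum, partialSum]
  · refine fun n _ => Continuous.intervalIntegrable (continuous_const.mul
      (.add (continuous_eraseSum fun _ _ _ _ => ?_) (continuous_eraseSum fun _ _ _ _ => ?_))) _ _
    · exact (hP.w _).mul (hP.term_const _ _ _ _ _)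
    · exact Continuous.mul (by fun_prop) (hP.term_const _ _ _ _ _)

lemma partialSum_succ_one (hP : P.IsContinuous) (N : ℕ) (t : ℝ) (V : List ℝ) (hs : List α)
    (gs : List β) :
    P.partialSum (N + 1) 1 t V hs gs = P.term 0 1 t V hs gs + ∫ s in (0 : ℝ)..t,
      (P.b * P.partialSum N 1 s V hs gs
        + -Complex.I * ((eraseSum gs fun g gs' => P.u g s * P.partialSum N 0 s V hs gs')
          + P.partialSum N 0 s (s :: V) hs gs)) := by
  rw [partialSum, Finset.sum_range_succ', add_comm]
  congr 1
  simp only [term_succ_one hP]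
  rw [← intervalIntegral.integral_finsetSum]
  · refine intervalIntegral.integral_congr fun s _ => ?_
    simp only [← Finset.mul_sum, Finset.sum_add_distrib, mul_partialSum_eraseSum, partialSum]
  · refine fun n _ => Continuous.intervalIntegrable (.add
      (continuous_const.mul (hP.term_const _ _ _ _ _)) (continuous_const.mul
        (.add (continuous_eraseSum fun _ _ _ _ => ?_) (hP.term_cons _ _ _ _ _)))) _ _
    exact (hP.u _).mul (hP.term_const _ _ _ _ _)

lemma IsContinuous.partialSum_const (hP : P.IsContinuous) (N : ℕ) (i : Fin 2) (V : List ℝ)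
    (hs : List α) (gs : List β) : Continuous fun t => P.partialSum N i t V hs gs :=
  continuous_finsetSum _ fun _ _ => hP.term_const _ _ _ _ _

lemma IsContinuous.partialSum_cons (hP : P.IsContinuous) (N : ℕ) (i : Fin 2) (V : List ℝ)
    (hs : List α) (gs : List β) : Continuous fun t => P.partialSum N i t (t :: V) hs gs :=
  continuous_finsetSum _ fun _ _ => hP.term_cons _ _ _ _ _

lemma IsContinuous.partialSum_singleton (hP : P.IsContinuous) (N : ℕ) (i : Fin 2)
    (hs : List α) (gs : List β) :
    Continuous fun p : ℝ × ℝ => P.partialSum N i p.2 [p.1] hs gs :=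
  continuous_finsetSum _ fun _ _ => hP.term_singleton _ _ _ _

lemma free_partialSum_of_ne_nil (N : ℕ) (i : Fin 2) (t : ℝ) {V : List ℝ} (hV : V ≠ [])
    (hs : List α) (gs : List β) : P.free.partialSum N i t V hs gs = 0 := by
  refine Finset.sum_eq_zero fun n _ => ?_
  simp [term, P.free_amp_of_ne_nil _ i hV, simplexIntegral_zero]

/-- The difference of the partial sums of the Dyson series and of the normally ordered series. -/
noncomputable def defect (P : Coupling α β) (N : ℕ) (i : Fin 2) (t : ℝ) (hs : List α)
    (gs : List β) : ℂ :=
  P.partialSum N i t [] hs gs - P.free.partialSum N i t [] hs gs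

/-- In the ground state with nothing pending, the first operator can only absorb an outgoing
particle. Both series share this step, so the defect passes to fewer particles without any error. -/
lemma defect_zero (hP : P.IsContinuous) (N : ℕ) (t : ℝ) (hs : List α) (gs : List β) :
    P.defect (N + 1) 0 t hs gs
      = ∫ s in (0 : ℝ)..t, -Complex.I * eraseSum hs fun h hs' => P.w h s * P.defect N 1 s hs' gs := by
  have h0 : P.free.term 0 0 t [] hs gs = P.term 0 0 t [] hs gs := by simp [term_zero, free]
  have hF := hP.free
  rw [defect, partialSum_succ_zero hP, partialSum_succ_zero hF, h0, add_sub_add_left_eq_sub,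
    ← intervalIntegral.integral_sub]
  · refine intervalIntegral.integral_congr fun s _ => ?_
    simp only [eraseSum_nil, add_zero, ← mul_sub]
    simp only [defect, eraseSum, mul_sub, Finset.sum_sub_distrib]
    rfl
  all_goals
    simp only [eraseSum_nil, add_zero]
    refine (continuous_const.mul (continuous_eraseSum fun _ _ _ _ => ?_)).intervalIntegrable _ _
  · exact (hP.w _).mul (hP.partialSum_const _ _ _ _ _)
  · exact (hF.w _).mul (hF.partialSum_const _ _ _ _ _)

/-- In the excited state the first integral again has one particle fewer. The second collects what
the free series lacks, the renormalization term and a newly opened contraction, and is where the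
cancellation takes place. -/
lemma defect_one (hP : P.IsContinuous) (N : ℕ) (t : ℝ) (hs : List α) (gs : List β) :
    P.defect (N + 1) 1 t hs gs
      = (∫ s in (0 : ℝ)..t, -Complex.I *
          eraseSum gs fun g gs' => P.u g s * P.defect N 0 s hs gs')
        + ∫ s in (0 : ℝ)..t, (P.b * P.partialSum N 1 s [] hs gs
          + -Complex.I * P.partialSum N 0 s [s] hs gs) := by
  have h0 : P.free.term 0 1 t [] hs gs = P.term 0 1 t [] hs gs := by simp [term_zero, free]
  have hF := hP.free
  have hc := fun gs' => hP.partialSum_const N 0 [] hs gs'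
  have hcF := fun gs' => hF.partialSum_const N 0 [] hs gs'
  have hb := hP.partialSum_const N 1 [] hs gs
  have hs' := hP.partialSum_cons N 0 [] hs gs
  have hsum : Continuous fun s => eraseSum gs fun g gs' => P.u g s * P.partialSum N 0 s [] hs gs' :=
    continuous_eraseSum fun _ _ _ _ => (hP.u _).mul (hc _)
  have hsumF : Continuous fun s =>
      eraseSum gs fun g gs' => P.u g s * P.free.partialSum N 0 s [] hs gs' :=
    continuous_eraseSum fun _ _ _ _ => (hP.u _).mul (hcF _)
  have hsumd : Continuous fun s => eraseSum gs fun g gs' => P.u g s * P.defect N 0 s hs gs' :=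
    continuous_eraseSum fun _ _ _ _ => (hP.u _).mul ((hc _).sub (hcF _))
  rw [defect, partialSum_succ_one hP, partialSum_succ_one hF, h0, add_sub_add_left_eq_sub,
    ← intervalIntegral.integral_sub, ← intervalIntegral.integral_add]
  · refine intervalIntegral.integral_congr fun s _ => ?_
    have hu : P.free.u = P.u := rfl
    have : (eraseSum gs fun g gs' => P.u g s * P.defect N 0 s hs gs')
        = (eraseSum gs fun g gs' => P.u g s * P.partialSum N 0 s [] hs gs')
          - eraseSum gs fun g gs' => P.u g s * P.free.partialSum N 0 s [] hs gs' := by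
      simp only [defect, eraseSum, ← Finset.sum_sub_distrib, mul_sub]
    simp only [this, free_partialSum_of_ne_nil N 0 s (List.cons_ne_nil _ _), free_b, hu]
    ring
  · exact (continuous_const.mul hsumd).intervalIntegrable _ _
  · exact ((continuous_const.mul hb).add (continuous_const.mul hs')).intervalIntegrable _ _
  · exact ((continuous_const.mul hb).add
      (continuous_const.mul (hsum.add hs'))).intervalIntegrable _ _
  · exact ((continuous_const.mul (hF.partialSum_const N 1 [] hs gs)).add
      (continuous_const.mul (hsumF.add (hF.partialSum_cons N 0 [] hs gs)))).intervalIntegrable _ _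

/-- The contraction of neighbouring operators cancels the renormalization term up to the deviation
of `D` from `b δ`; what remains besides are the contractions of operators that are not neighbours. -/
lemma integral_contraction_eq (hP : P.IsContinuous) (N : ℕ) {t : ℝ} (ht : 0 ≤ t) (hs : List α)
    (gs : List β) :
    ∫ s in (0 : ℝ)..t, (P.b * P.partialSum (N + 1) 1 s [] hs gs
        + -Complex.I * P.partialSum (N + 1) 0 s [s] hs gs)
      = (∫ s in (0 : ℝ)..t, P.b * P.term N 1 s [] hs gs)
        + (∫ r in (0 : ℝ)..t, (P.b - ∫ x in (0 : ℝ)..(t - r), P.D x) * P.partialSum N 1 r [] hs gs)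
        - ∫ s in (0 : ℝ)..t, ∫ r in (0 : ℝ)..s,
          eraseSum hs fun h hs' => P.w h r * P.partialSum N 1 r [s] hs' gs := by
  have hD := hP.D
  have hS := hP.partialSum_const N 1 [] hs gs
  have hT := hP.term_const N 1 [] hs gs
  have hconv : Continuous fun p : ℝ × ℝ => P.D (p.1 - p.2) * P.partialSum N 1 p.2 [] hs gs :=
    Continuous.mul (by fun_prop) (hS.comp continuous_snd)
  have hrest : Continuous fun p : ℝ × ℝ =>
      eraseSum hs fun h hs' => P.w h p.2 * P.partialSum N 1 p.2 [p.1] hs' gs :=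
    continuous_eraseSum fun _ _ _ _ =>
      ((hP.w _).comp continuous_snd).mul (hP.partialSum_singleton _ _ _ _)
  have hconv' : Continuous fun s => ∫ r in (0 : ℝ)..s, P.D (s - r) * P.partialSum N 1 r [] hs gs :=
    intervalIntegral.continuous_parametric_intervalIntegral_of_continuous hconv continuous_id
  have hrest' : Continuous fun s => ∫ r in (0 : ℝ)..s,
      eraseSum hs fun h hs' => P.w h r * P.partialSum N 1 r [s] hs' gs :=
    intervalIntegral.continuous_parametric_intervalIntegral_of_continuous
      (f := fun s r => eraseSum hs fun h hs' => P.w h r * P.partialSum N 1 r [s] hs' gs)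
      hrest continuous_id
  -- The recursion is unrolled once more: the next operator is a creator, which either closes the
  -- contraction opened at `s` or absorbs an outgoing particle and leaves it pending. The sign is
  -- `(-i)² = -1`.
  have hinner : ∀ s, -Complex.I * P.partialSum (N + 1) 0 s [s] hs gs
      = -(∫ r in (0 : ℝ)..s, P.D (s - r) * P.partialSum N 1 r [] hs gs)
        - ∫ r in (0 : ℝ)..s, eraseSum hs fun h hs' => P.w h r * P.partialSum N 1 r [s] hs' gs := by
    intro s
    have h0 : P.term 0 0 s [s] hs gs = 0 := by simp [term_zero]
    rw [partialSum_succ_zero hP, h0, zero_add, intervalIntegral.integral_const_mul, ← mul_assoc,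
      neg_mul_neg, Complex.I_mul_I, neg_one_mul]
    simp only [eraseSum_cons, eraseSum_nil, add_zero]
    rw [intervalIntegral.integral_add, neg_add', neg_sub_left, add_comm, ← neg_sub_left]
    · exact (hrest.comp (by fun_prop : Continuous fun r : ℝ => (s, r))).intervalIntegrable _ _
    · exact (hconv.comp (by fun_prop : Continuous fun r : ℝ => (s, r))).intervalIntegrable _ _
  -- After the exchange of integrals `D` is integrated first, so that its primitive can be compared
  -- with `b`.
  have hfub : ∫ s in (0 : ℝ)..t, ∫ r in (0 : ℝ)..s, P.D (s - r) * P.partialSum N 1 r [] hs gs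
      = ∫ r in (0 : ℝ)..t, (∫ x in (0 : ℝ)..(t - r), P.D x) * P.partialSum N 1 r [] hs gs := by
    rw [intervalIntegral_triangle_swap
      (g := fun s r => P.D (s - r) * P.partialSum N 1 r [] hs gs) hconv ht]
    refine intervalIntegral.integral_congr fun r _ => ?_
    simp only [intervalIntegral.integral_mul_const]
    rw [intervalIntegral.integral_comp_sub_right P.D r, sub_self]
  have hprim : Continuous fun r => ∫ x in (0 : ℝ)..(t - r), P.D x :=
    (intervalIntegral.continuous_primitive (fun a b => hD.intervalIntegrable a b) 0).comp
      (continuous_const.sub continuous_id)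
  -- A contraction uses two orders of the series and the term `b` only one; the truncated sums
  -- therefore cancel up to the single term of order `N`.
  have hsplit : ∀ s, P.b * P.partialSum (N + 1) 1 s [] hs gs
      + -Complex.I * P.partialSum (N + 1) 0 s [s] hs gs
      = (P.b * P.term N 1 s [] hs gs + (P.b * P.partialSum N 1 s [] hs gs
        - ∫ r in (0 : ℝ)..s, P.D (s - r) * P.partialSum N 1 r [] hs gs))
        - ∫ r in (0 : ℝ)..s,
          eraseSum hs fun h hs' => P.w h r * P.partialSum N 1 r [s] hs' gs := by
    intro s
    rw [hinner, partialSum, Finset.sum_range_succ, ← partialSum]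
    ring
  simp only [hsplit]
  rw [intervalIntegral.integral_sub, intervalIntegral.integral_add, intervalIntegral.integral_sub,
    hfub, ← intervalIntegral.integral_sub]
  · simp only [sub_mul]
  all_goals
    refine Continuous.intervalIntegrable ?_ _ _
    fun_prop

end Coupling

/-! ### Estimate of the defect by induction on the number of particles -/

lemma norm_eraseSum_mul_le {γ : Type*} {l : List γ} {a : γ → ℂ} {x : γ → List γ → ℂ} {c : ℝ}
    (h : ∀ k : Fin l.length, ‖x l[k] (l.eraseIdx k)‖ ≤ c) :
    ‖eraseSum l fun y l' => a y * x y l'‖ ≤ (l.map fun y => ‖a y‖).sum * c := by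
  refine (norm_eraseSum_le _ _).trans ?_
  rw [← eraseSum_const, eraseSum_mul]
  refine Finset.sum_le_sum fun k _ => ?_
  exact (norm_mul_le _ _).trans (mul_le_mul_of_nonneg_left (h k) (norm_nonneg _))

lemma length_eraseIdx_add_one {γ : Type*} (l : List γ) (k : Fin l.length) :
    (l.eraseIdx k).length + 1 = l.length := by
  rw [List.length_eraseIdx_of_lt k.2]
  have := k.2
  omega

namespace Coupling

variable {α β : Type*} {P : Coupling α β}

/-- The bounds on a coupling on which the estimates of the Dyson series depend: a bound `K` for the
scalar products of the particles in sublists of `hs` and `gs`, and bounds `C` and `W` for the `L¹`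
norms on `[0, T]` of the commutator function and of the pairings. -/
structure Bounds (P : Coupling α β) (K C W T : ℝ) (hs : List α) (gs : List β) : Prop where
  continuous : P.IsContinuous
  nonneg : 0 ≤ K
  scalar : ∀ hs' gs', hs'.Sublist hs → gs'.Sublist gs → ‖P.c hs' gs'‖ ≤ K
  commutator : ∫ r in (0 : ℝ)..T, ‖P.D r‖ ≤ C
  pairing : ∫ r in (0 : ℝ)..T, P.pairingNorm hs gs r ≤ W

/-- The resulting bound for the sum of the absolute values of the terms. -/
noncomputable def totalBound (P : Coupling α β) (K C W T : ℝ) : ℝ :=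
  K * Real.exp ((‖P.b‖ + C) * T + W)

namespace Bounds

variable {K C W T : ℝ} {hs₀ : List α} {gs₀ : List β}

lemma C_nonneg (h : P.Bounds K C W T hs₀ gs₀) (hT : 0 ≤ T) : 0 ≤ C :=
  (intervalIntegral.integral_nonneg hT fun _ _ => norm_nonneg _).trans h.commutator

lemma W_nonneg (h : P.Bounds K C W T hs₀ gs₀) (hT : 0 ≤ T) : 0 ≤ W :=
  (intervalIntegral.integral_nonneg hT fun _ _ => pairingNorm_nonneg _ _ _).trans h.pairing

lemma totalBound_nonneg (h : P.Bounds K C W T hs₀ gs₀) : 0 ≤ P.totalBound K C W T :=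
  mul_nonneg h.nonneg (Real.exp_pos _).le

lemma integral_pairingNorm_le (h : P.Bounds K C W T hs₀ gs₀) {t : ℝ} (ht : t ∈ Set.Icc 0 T) :
    ∫ r in (0 : ℝ)..t, P.pairingNorm hs₀ gs₀ r ≤ W :=
  (intervalIntegral.integral_mono_interval le_rfl ht.1 ht.2
    (Eventually.of_forall fun _ => pairingNorm_nonneg _ _ _)
    ((h.continuous.pairingNorm _ _).intervalIntegrable _ _)).trans h.pairing

lemma sum_norm_term_le (h : P.Bounds K C W T hs₀ gs₀) (N : ℕ) (i : Fin 2) {t : ℝ}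
    (ht : t ∈ Set.Icc 0 T) (V : List ℝ) {hs : List α} {gs : List β}
    (hhs : hs.Sublist hs₀) (hgs : gs.Sublist gs₀) :
    ∑ n ∈ Finset.range N, ‖P.term n i t V hs gs‖
      ≤ P.totalBound K C W T * P.contractionBound V t := by
  refine (Coupling.sum_norm_term_le h.continuous h.nonneg h.commutator h.scalar N i ht V hhs
    hgs).trans (mul_le_mul_of_nonneg_right ?_ (contractionBound_nonneg V ht.1))
  refine mul_le_mul_of_nonneg_left (Real.exp_le_exp.2 ?_) h.nonneg
  rw [intervalIntegral.integral_add (continuous_const.intervalIntegrable _ _)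
    ((h.continuous.pairingNorm _ _).intervalIntegrable _ _), intervalIntegral.integral_const]
  refine add_le_add ?_ (h.integral_pairingNorm_le ht)
  rw [smul_eq_mul, mul_comm, sub_zero]
  exact mul_le_mul_of_nonneg_left ht.2
    (add_nonneg (norm_nonneg _) (h.C_nonneg (ht.1.trans ht.2)))

lemma sum_norm_term_nil_le (h : P.Bounds K C W T hs₀ gs₀) (N : ℕ) (i : Fin 2) {t : ℝ}
    (ht : t ∈ Set.Icc 0 T) {hs : List α} {gs : List β}
    (hhs : hs.Sublist hs₀) (hgs : gs.Sublist gs₀) :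
    ∑ n ∈ Finset.range N, ‖P.term n i t [] hs gs‖ ≤ P.totalBound K C W T := by
  simpa [contractionBound] using h.sum_norm_term_le N i ht [] hhs hgs

lemma norm_partialSum_le (h : P.Bounds K C W T hs₀ gs₀) (N : ℕ) (i : Fin 2) {t : ℝ}
    (ht : t ∈ Set.Icc 0 T) (V : List ℝ) {hs : List α} {gs : List β}
    (hhs : hs.Sublist hs₀) (hgs : gs.Sublist gs₀) :
    ‖P.partialSum N i t V hs gs‖ ≤ P.totalBound K C W T * P.contractionBound V t :=
  (norm_sum_le _ _).trans (h.sum_norm_term_le N i ht V hhs hgs)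

lemma summable_term (h : P.Bounds K C W T hs₀ gs₀) (i : Fin 2) {t : ℝ} (ht : t ∈ Set.Icc 0 T) :
    Summable fun n => P.term n i t [] hs₀ gs₀ :=
  .of_norm (summable_of_sum_range_le (fun _ => norm_nonneg _) fun N =>
    h.sum_norm_term_nil_le N i ht (List.Sublist.refl _) (List.Sublist.refl _))

lemma free (h : P.Bounds K C W T hs₀ gs₀) : P.free.Bounds K 0 W T hs₀ gs₀ where
  continuous := h.continuous.free
  nonneg := h.nonneg
  scalar := h.scalar
  commutator := by simp
  pairing := h.pairing

/-- These integrals are summable, because the sums of the absolute values are bounded uniformly on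
`[0, T]`. This removes the truncation error in `integral_contraction_eq`. -/
lemma tendsto_integral_norm_term (h : P.Bounds K C W T hs₀ gs₀) (hT : 0 ≤ T) (i : Fin 2)
    {hs : List α} {gs : List β} (hhs : hs.Sublist hs₀) (hgs : gs.Sublist gs₀) :
    Tendsto (fun n => ∫ s in (0 : ℝ)..T, ‖P.term n i s [] hs gs‖) atTop (𝓝 0) := by
  have hc := fun n => (h.continuous.term_const n i [] hs gs).norm
  refine (summable_of_sum_range_le (c := P.totalBound K C W T * T)
    (fun n => intervalIntegral.integral_nonneg hT fun _ _ => norm_nonneg _)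
    fun N => ?_).tendsto_atTop_zero
  rw [← intervalIntegral.integral_finsetSum fun n _ => (hc n).intervalIntegrable _ _]
  calc _ ≤ ∫ _ in (0 : ℝ)..T, P.totalBound K C W T :=
        intervalIntegral.integral_mono_on hT
          ((continuous_finsetSum _ fun n _ => hc n).intervalIntegrable _ _)
          (continuous_const.intervalIntegrable _ _)
          fun s hs => h.sum_norm_term_nil_le N i hs hhs hgs
    _ = _ := by simp [mul_comm]

/-- The three parts of `integral_contraction_eq` are bounded separately: the truncation error, the
deviation `κ₁` of the primitive of `D` from `b`, and `κ₂` for contractions that stay open past an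
outgoing particle. In the last part smallness comes from the factor that `contractionBound` attaches
to the pending time. -/
lemma norm_integral_contraction_le (h : P.Bounds K C W T hs₀ gs₀) {κ₁ κ₂ : ℝ}
    (h₁ : ∫ x in (0 : ℝ)..T, ‖P.b - ∫ y in (0 : ℝ)..x, P.D y‖ ≤ κ₁)
    (h₂ : ∀ s ∈ Set.Icc 0 T, ∫ r in (0 : ℝ)..s,
      P.pairingNorm hs₀ gs₀ r * ∫ x in (0 : ℝ)..r, ‖P.D (s - x)‖ ≤ κ₂)
    (N : ℕ) {t : ℝ} (ht : t ∈ Set.Icc 0 T) {hs : List α} {gs : List β}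
    (hhs : hs.Sublist hs₀) (hgs : gs.Sublist gs₀) :
    ‖∫ s in (0 : ℝ)..t, (P.b * P.partialSum (N + 1) 1 s [] hs gs
        + -Complex.I * P.partialSum (N + 1) 0 s [s] hs gs)‖
      ≤ ‖P.b‖ * (∫ s in (0 : ℝ)..T, ‖P.term N 1 s [] hs gs‖)
        + P.totalBound K C W T * (κ₁ + T * κ₂) := by
  have hP := h.continuous
  have hD := hP.D
  have hIcc : ∀ s ∈ Set.Icc 0 t, s ∈ Set.Icc 0 T := fun s h => ⟨h.1, h.2.trans ht.2⟩
  have hM := h.totalBound_nonneg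
  have hprim : Continuous fun x => ∫ y in (0 : ℝ)..x, P.D y :=
    intervalIntegral.continuous_primitive (fun a b => hD.intervalIntegrable a b) 0
  have hp := hP.pairingNorm hs₀ gs₀
  have hterm := hP.term_const N 1 [] hs gs
  have hpart := hP.partialSum_const N 1 [] hs gs
  rw [integral_contraction_eq hP N ht.1]
  have e₁ : ‖∫ s in (0 : ℝ)..t, P.b * P.term N 1 s [] hs gs‖
      ≤ ‖P.b‖ * ∫ s in (0 : ℝ)..T, ‖P.term N 1 s [] hs gs‖ := by
    rw [intervalIntegral.integral_const_mul, norm_mul]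
    refine mul_le_mul_of_nonneg_left ((intervalIntegral.norm_integral_le_integral_norm ht.1).trans
      ?_) (norm_nonneg _)
    exact intervalIntegral.integral_mono_interval le_rfl ht.1 ht.2
      (Eventually.of_forall fun _ => norm_nonneg _) (hterm.norm.intervalIntegrable _ _)
  have e₂ : ‖∫ r in (0 : ℝ)..t,
        (P.b - ∫ x in (0 : ℝ)..(t - r), P.D x) * P.partialSum N 1 r [] hs gs‖
      ≤ P.totalBound K C W T * κ₁ := by
    refine (intervalIntegral.norm_integral_le_integral_norm ht.1).trans ?_
    calc _ ≤ ∫ r in (0 : ℝ)..t,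
          P.totalBound K C W T * ‖P.b - ∫ x in (0 : ℝ)..(t - r), P.D x‖ := by
          refine intervalIntegral.integral_mono_on ht.1
            (Continuous.intervalIntegrable (by fun_prop) _ _)
            (Continuous.intervalIntegrable (by fun_prop) _ _) fun r hr => ?_
          rw [norm_mul, mul_comm]
          refine mul_le_mul_of_nonneg_right ?_ (norm_nonneg _)
          simpa [contractionBound] using h.norm_partialSum_le N 1 (hIcc r hr) [] hhs hgs
      _ = P.totalBound K C W T * ∫ x in (0 : ℝ)..t, ‖P.b - ∫ y in (0 : ℝ)..x, P.D y‖ := by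
          rw [intervalIntegral.integral_const_mul, intervalIntegral.integral_comp_sub_left
            (fun x => ‖P.b - ∫ y in (0 : ℝ)..x, P.D y‖), sub_self, sub_zero]
      _ ≤ _ := mul_le_mul_of_nonneg_left ((intervalIntegral.integral_mono_interval le_rfl ht.1
          ht.2 (Eventually.of_forall fun _ => norm_nonneg _)
          (Continuous.intervalIntegrable (by fun_prop) _ _)).trans h₁) hM
  have e₃ : ‖∫ s in (0 : ℝ)..t, ∫ r in (0 : ℝ)..s,
        eraseSum hs fun h hs' => P.w h r * P.partialSum N 1 r [s] hs' gs‖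
      ≤ P.totalBound K C W T * (T * κ₂) := by
    -- At `s = 0` the left side of `h₂` vanishes.
    have hκ₂ : 0 ≤ κ₂ := by
      have hT : (0 : ℝ) ∈ Set.Icc 0 T := ⟨le_rfl, ht.1.trans ht.2⟩
      simpa using h₂ 0 hT
    have hb : ∀ s ∈ Set.uIoc 0 t, ‖∫ r in (0 : ℝ)..s,
        eraseSum hs fun h hs' => P.w h r * P.partialSum N 1 r [s] hs' gs‖
        ≤ P.totalBound K C W T * κ₂ := by
      intro s hs'
      rw [Set.uIoc_of_le ht.1] at hs'
      have hsT := hIcc s ⟨hs'.1.le, hs'.2⟩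
      have hprim' : Continuous fun r => ∫ x in (0 : ℝ)..r, ‖P.D (s - x)‖ :=
        intervalIntegral.continuous_primitive
          (fun a b => Continuous.intervalIntegrable (by fun_prop) a b) 0
      refine (intervalIntegral.norm_integral_le_integral_norm hsT.1).trans ?_
      calc _ ≤ ∫ r in (0 : ℝ)..s, P.totalBound K C W T *
            (P.pairingNorm hs₀ gs₀ r * ∫ x in (0 : ℝ)..r, ‖P.D (s - x)‖) := by
            refine intervalIntegral.integral_mono_on hsT.1
              (Continuous.intervalIntegrable ?_ _ _)
              (Continuous.intervalIntegrable (by fun_prop) _ _) fun r hr => ?_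
            · refine (continuous_eraseSum fun _ _ _ _ => (hP.w _).mul ?_).norm
              exact (hP.partialSum_singleton _ _ _ _).comp
                (by fun_prop : Continuous fun r : ℝ => (s, r))
            · have hrT : r ∈ Set.Icc 0 T := ⟨hr.1, hr.2.trans hsT.2⟩
              have hcb : P.contractionBound [s] r = ∫ x in (0 : ℝ)..r, ‖P.D (s - x)‖ := by
                simp [contractionBound]
              refine (norm_eraseSum_mul_le fun k => h.norm_partialSum_le N 1 hrT [s]
                ((List.eraseIdx_sublist _ _).trans hhs) hgs).trans ?_
              rw [hcb, mul_left_comm]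
              refine mul_le_mul_of_nonneg_left (mul_le_mul_of_nonneg_right ?_
                (hcb ▸ contractionBound_nonneg _ hr.1)) hM
              refine (sum_map_le_of_sublist hhs fun _ => norm_nonneg _).trans ?_
              exact le_add_of_nonneg_right (List.sum_nonneg (by simp))
        _ ≤ _ := by
            rw [intervalIntegral.integral_const_mul]
            exact mul_le_mul_of_nonneg_left (h₂ s hsT) hM
    refine (intervalIntegral.norm_integral_le_of_norm_le_const hb).trans ?_
    rw [sub_zero, abs_of_nonneg ht.1, mul_assoc, mul_comm κ₂]
    exact mul_le_mul_of_nonneg_left (mul_le_mul_of_nonneg_right ht.2 hκ₂) hM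
  refine (norm_sub_le _ _).trans ?_
  have := norm_add_le (∫ s in (0 : ℝ)..t, P.b * P.term N 1 s [] hs gs)
    (∫ r in (0 : ℝ)..t, (P.b - ∫ x in (0 : ℝ)..(t - r), P.D x) * P.partialSum N 1 r [] hs gs)
  linarith

lemma norm_integral_pairing_le (h : P.Bounds K C W T hs₀ gs₀) {t : ℝ} (ht : t ∈ Set.Icc 0 T)
    {f : ℝ → ℂ} {q : ℝ → ℝ} {c : ℝ} (hc : 0 ≤ c) (hq : ∀ s, q s ≤ P.pairingNorm hs₀ gs₀ s)
    (hf : ∀ s ∈ Set.Icc 0 t, ‖f s‖ ≤ q s * c) :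
    ‖∫ s in (0 : ℝ)..t, -Complex.I * f s‖ ≤ W * c := by
  have hp := h.continuous.pairingNorm hs₀ gs₀
  calc _ ≤ ∫ s in (0 : ℝ)..t, P.pairingNorm hs₀ gs₀ s * c := by
        refine intervalIntegral.norm_integral_le_of_norm_le ht.1 ?_
          (Continuous.intervalIntegrable (by fun_prop) _ _)
        refine Eventually.of_forall fun s hs => ?_
        rw [norm_mul, norm_neg, Complex.norm_I, one_mul]
        exact (hf s ⟨hs.1.le, hs.2⟩).trans (mul_le_mul_of_nonneg_right (hq s) hc)
    _ ≤ _ := by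
        rw [intervalIntegral.integral_mul_const]
        exact mul_le_mul_of_nonneg_right (h.integral_pairingNorm_le ht) hc

/-- Each recursion step removes a particle at the cost of a factor `W` and may add an error `κ`,
whence `κ * (1 + W) ^ m`. No defect with the same particles appears on the right, so the recursion
ends after finitely many steps. -/
lemma eventually_norm_defect_le (h : P.Bounds K C W T hs₀ gs₀) (hT : 0 ≤ T) {κ₁ κ₂ κ : ℝ}
    (h₁ : ∫ x in (0 : ℝ)..T, ‖P.b - ∫ y in (0 : ℝ)..x, P.D y‖ ≤ κ₁)
    (h₂ : ∀ s ∈ Set.Icc 0 T, ∫ r in (0 : ℝ)..s,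
      P.pairingNorm hs₀ gs₀ r * ∫ x in (0 : ℝ)..r, ‖P.D (s - x)‖ ≤ κ₂)
    (hκ0 : 0 ≤ κ) (hκ : P.totalBound K C W T * (κ₁ + T * κ₂) < κ)
    (m : ℕ) {hs : List α} {gs : List β} (hhs : hs.Sublist hs₀) (hgs : gs.Sublist gs₀)
    (hm : hs.length + gs.length < m) :
    ∀ᶠ N in atTop, ∀ t ∈ Set.Icc 0 T, ∀ i, ‖P.defect N i t hs gs‖ ≤ κ * (1 + W) ^ m := by
  have hW := h.W_nonneg hT
  induction m generalizing hs gs with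
  | zero => omega
  | succ m ih =>
    have hc : 0 ≤ κ * (1 + W) ^ m := by positivity
    have hpow : κ + W * (κ * (1 + W) ^ m) ≤ κ * (1 + W) ^ (m + 1) := by
      have : κ * 1 ≤ κ * (1 + W) ^ m :=
        mul_le_mul_of_nonneg_left (one_le_pow₀ (by linarith)) hκ0
      rw [pow_succ]
      linarith
    have hA : ∀ᶠ N in atTop, ∀ k : Fin hs.length, ∀ t ∈ Set.Icc 0 T, ∀ i,
        ‖P.defect N i t (hs.eraseIdx k) gs‖ ≤ κ * (1 + W) ^ m :=
      eventually_all.2 fun k => ih ((List.eraseIdx_sublist _ _).trans hhs) hgs (by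
        have := length_eraseIdx_add_one hs k; omega)
    have hB : ∀ᶠ N in atTop, ∀ k : Fin gs.length, ∀ t ∈ Set.Icc 0 T, ∀ i,
        ‖P.defect N i t hs (gs.eraseIdx k)‖ ≤ κ * (1 + W) ^ m :=
      eventually_all.2 fun k => ih hhs ((List.eraseIdx_sublist _ _).trans hgs) (by
        have := length_eraseIdx_add_one gs k; omega)
    -- The strict inequality `hκ` leaves room for the truncation error once `N` is large.
    have hR : ∀ᶠ N in atTop, ‖P.b‖ * (∫ s in (0 : ℝ)..T, ‖P.term N 1 s [] hs gs‖)
        + P.totalBound K C W T * (κ₁ + T * κ₂) ≤ κ := by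
      have := ((h.tendsto_integral_norm_term hT 1 hhs hgs).const_mul ‖P.b‖).add_const
        (P.totalBound K C W T * (κ₁ + T * κ₂))
      rw [mul_zero, zero_add] at this
      exact this.eventually_le_const hκ
    -- The shift by two consists of one order for the step of the defect and one for unrolling the
    -- contraction.
    have key : ∀ᶠ N in atTop, ∀ t ∈ Set.Icc 0 T, ∀ i,
        ‖P.defect (N + 1 + 1) i t hs gs‖ ≤ κ * (1 + W) ^ (m + 1) := by
      filter_upwards [(tendsto_add_atTop_nat 1).eventually hA,
        (tendsto_add_atTop_nat 1).eventually hB, hR] with N hA hB hR t ht i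
      have hIcc : ∀ s ∈ Set.Icc 0 t, s ∈ Set.Icc 0 T := fun s h => ⟨h.1, h.2.trans ht.2⟩
      fin_cases i
      · rw [Fin.zero_eta, defect_zero h.continuous]
        refine le_trans ?_ ((le_add_of_nonneg_left hκ0).trans hpow)
        refine h.norm_integral_pairing_le ht hc (q := fun s => (hs.map fun h => ‖P.w h s‖).sum)
          (fun s => ?_) fun s hst => norm_eraseSum_mul_le fun k => hA k s (hIcc s hst) 1
        exact (sum_map_le_of_sublist hhs fun _ => norm_nonneg _).trans
          (le_add_of_nonneg_right (List.sum_nonneg (by simp)))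
      · rw [Fin.mk_one, defect_one h.continuous]
        refine (norm_add_le _ _).trans (le_trans ?_ hpow)
        rw [add_comm]
        refine add_le_add ((h.norm_integral_contraction_le h₁ h₂ N ht hhs hgs).trans hR) ?_
        refine h.norm_integral_pairing_le ht hc (q := fun s => (gs.map fun g => ‖P.u g s‖).sum)
          (fun s => ?_) fun s hst => norm_eraseSum_mul_le fun k => hB k s (hIcc s hst) 0
        exact (sum_map_le_of_sublist hgs fun _ => norm_nonneg _).trans
          (le_add_of_nonneg_left (List.sum_nonneg (by simp)))
    exact (eventually_map (m := fun N => N + 2) (f := atTop)).2 key |>.filter_mono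
      (le_of_eq (map_add_atTop_eq_nat 2).symm)

theorem norm_tsum_sub_tsum_free_le (h : P.Bounds K C W T hs₀ gs₀) {κ₁ κ₂ κ : ℝ}
    (h₁ : ∫ x in (0 : ℝ)..T, ‖P.b - ∫ y in (0 : ℝ)..x, P.D y‖ ≤ κ₁)
    (h₂ : ∀ s ∈ Set.Icc 0 T, ∫ r in (0 : ℝ)..s,
      P.pairingNorm hs₀ gs₀ r * ∫ x in (0 : ℝ)..r, ‖P.D (s - x)‖ ≤ κ₂)
    (hκ0 : 0 ≤ κ) (hκ : P.totalBound K C W T * (κ₁ + T * κ₂) < κ) (i : Fin 2) {t : ℝ}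
    (ht : t ∈ Set.Icc 0 T) :
    ‖(∑' n, P.term n i t [] hs₀ gs₀) - ∑' n, P.free.term n i t [] hs₀ gs₀‖
      ≤ κ * (1 + W) ^ (hs₀.length + gs₀.length + 1) := by
  have hlim := ((h.summable_term i ht).hasSum.tendsto_sum_nat.sub
    (h.free.summable_term i ht).hasSum.tendsto_sum_nat).norm
  refine le_of_tendsto hlim ?_
  filter_upwards [h.eventually_norm_defect_le (ht.1.trans ht.2) h₁ h₂ hκ0 hκ _
    (List.Sublist.refl _) (List.Sublist.refl _) (Nat.lt_succ_self _)] with N hN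
  exact hN t ht i

end Bounds

end Coupling

/-! ### Smallness of the errors for approximate half-line deltas -/

/-- Beyond `η` the primitive differs from `b` by the mass defect plus the tail, at most `2 * θ`; on
`[0, η]` the crude bound `‖b‖ + C` is multiplied by a short length. -/
lemma integral_norm_sub_primitive_le {D : ℝ → ℂ} (hD : Continuous D) {b : ℂ} {C T η θ : ℝ}
    (hη : 0 < η) (hηT : η < T) (hC : ∫ r in (0 : ℝ)..T, ‖D r‖ ≤ C)
    (htail : ∫ r in η..T, ‖D r‖ ≤ θ) (hmass : ‖b - ∫ r in (0 : ℝ)..η, D r‖ ≤ θ) :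
    ∫ x in (0 : ℝ)..T, ‖b - ∫ y in (0 : ℝ)..x, D y‖ ≤ η * (‖b‖ + C) + T * (2 * θ) := by
  have hint : ∀ a c, IntervalIntegrable D volume a c := fun a c => hD.intervalIntegrable a c
  have hprim : Continuous fun x => ∫ y in (0 : ℝ)..x, D y :=
    intervalIntegral.continuous_primitive hint 0
  have hi : ∀ a c, IntervalIntegrable (fun x => ‖b - ∫ y in (0 : ℝ)..x, D y‖) volume a c :=
    fun a c => Continuous.intervalIntegrable (by fun_prop) a c
  have hθ : 0 ≤ θ := (norm_nonneg _).trans hmass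
  rw [← intervalIntegral.integral_add_adjacent_intervals (hi 0 η) (hi η T)]
  refine add_le_add ?_ ?_
  · calc _ ≤ ∫ _ in (0 : ℝ)..η, (‖b‖ + C) := by
          refine intervalIntegral.integral_mono_on hη.le (hi _ _)
            (continuous_const.intervalIntegrable _ _) fun x hx => (norm_sub_le _ _).trans ?_
          refine add_le_add le_rfl
            ((intervalIntegral.norm_integral_le_integral_norm hx.1).trans (le_trans ?_ hC))
          exact intervalIntegral.integral_mono_interval le_rfl hx.1 (hx.2.trans hηT.le)
            (Eventually.of_forall fun _ => norm_nonneg _) (hD.norm.intervalIntegrable _ _)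
      _ = _ := by simp [mul_add]
  · calc _ ≤ ∫ _ in η..T, 2 * θ := by
          refine intervalIntegral.integral_mono_on hηT.le (hi _ _)
            (continuous_const.intervalIntegrable _ _) fun x hx => ?_
          rw [← intervalIntegral.integral_add_adjacent_intervals (hint 0 η) (hint η x), ← sub_sub,
            two_mul]
          refine (norm_sub_le _ _).trans (add_le_add hmass ?_)
          refine (intervalIntegral.norm_integral_le_integral_norm hx.1).trans (le_trans ?_ htail)
          exact intervalIntegral.integral_mono_interval le_rfl hx.1 hx.2
            (Eventually.of_forall fun _ => norm_nonneg _) (hD.norm.intervalIntegrable _ _)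
      _ = (T - η) * (2 * θ) := by rw [intervalIntegral.integral_const, smul_eq_mul]
      _ ≤ _ := mul_le_mul_of_nonneg_right (by linarith) (by linarith)

/-- Young's inequality `p ≤ (lam * p² + 1 / lam) / 2`. Over short intervals it makes the integral of
`p` uniformly small, given only an `L²` bound. -/
lemma integral_le_of_integral_sq_le {p : ℝ → ℝ} (hp : Continuous p) {T L lam a s : ℝ}
    (hlam : 0 < lam) (hL : ∫ r in (0 : ℝ)..T, p r ^ 2 ≤ L) (ha : 0 ≤ a) (has : a ≤ s)
    (hs : s ≤ T) : ∫ r in a..s, p r ≤ (lam * L + (s - a) / lam) / 2 := by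
  have hL' : ∫ r in a..s, p r ^ 2 ≤ L :=
    (intervalIntegral.integral_mono_interval ha has hs
      (Eventually.of_forall fun _ => sq_nonneg _)
      (Continuous.intervalIntegrable (by fun_prop) _ _)).trans hL
  calc ∫ r in a..s, p r ≤ ∫ r in a..s, (lam / 2 * p r ^ 2 + 1 / (2 * lam)) := by
        refine intervalIntegral.integral_mono_on has (hp.intervalIntegrable _ _)
          (Continuous.intervalIntegrable (by fun_prop) _ _) fun r _ => ?_
        have : lam / 2 * p r ^ 2 + 1 / (2 * lam) - p r = (lam * p r - 1) ^ 2 / (2 * lam) := by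
          field_simp
          ring
        have : 0 ≤ (lam * p r - 1) ^ 2 / (2 * lam) := by positivity
        linarith
    _ = lam / 2 * (∫ r in a..s, p r ^ 2) + (s - a) * (1 / (2 * lam)) := by
        rw [intervalIntegral.integral_add (Continuous.intervalIntegrable (by fun_prop) _ _)
          (continuous_const.intervalIntegrable _ _), intervalIntegral.integral_const_mul,
          intervalIntegral.integral_const, smul_eq_mul]
    _ ≤ lam / 2 * L + (s - a) * (1 / (2 * lam)) := by gcongr
    _ = _ := by field_simp

/-- For `r ≤ s - η` the inner integral sees only the tail of `D`. For `r` within `η` of `s` it is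
merely bounded by `C`, and smallness comes from `p`; an `L¹` bound on `p` would not suffice, since
its mass could concentrate there. -/
lemma integral_mul_integral_norm_le {D : ℝ → ℂ} (hD : Continuous D) {p : ℝ → ℝ}
    (hp : Continuous p) (hp0 : ∀ r, 0 ≤ p r) {C W L T η θ lam : ℝ}
    (hη : 0 < η) (hlam : 0 < lam)
    (hC : ∫ r in (0 : ℝ)..T, ‖D r‖ ≤ C) (htail : ∫ r in η..T, ‖D r‖ ≤ θ) (hθ : 0 ≤ θ)
    (hW : ∫ r in (0 : ℝ)..T, p r ≤ W) (hL : ∫ r in (0 : ℝ)..T, p r ^ 2 ≤ L) {s : ℝ}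
    (hs : s ∈ Set.Icc 0 T) :
    ∫ r in (0 : ℝ)..s, p r * ∫ x in (0 : ℝ)..r, ‖D (s - x)‖
      ≤ W * θ + (lam * L + η / lam) / 2 * C := by
  have hC0 : 0 ≤ C :=
    (intervalIntegral.integral_nonneg (hs.1.trans hs.2) fun _ _ => norm_nonneg _).trans hC
  have hprim : Continuous fun r => ∫ x in (0 : ℝ)..r, ‖D (s - x)‖ :=
    intervalIntegral.continuous_primitive
      (fun a b => Continuous.intervalIntegrable (by fun_prop) a b) 0
  have hi : ∀ a c, IntervalIntegrable (fun r => p r * ∫ x in (0 : ℝ)..r, ‖D (s - x)‖)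
      volume a c := fun a c => Continuous.intervalIntegrable (by fun_prop) a c
  have hshift : ∀ r, ∫ x in (0 : ℝ)..r, ‖D (s - x)‖ = ∫ x in (s - r)..s, ‖D x‖ := fun r => by
    rw [intervalIntegral.integral_comp_sub_left (fun x => ‖D x‖) s, sub_zero]
  set a := max 0 (s - η) with ha
  have ha0 : 0 ≤ a := le_max_left _ _
  have has : a ≤ s := max_le hs.1 (by linarith)
  rw [← intervalIntegral.integral_add_adjacent_intervals (hi 0 a) (hi a s)]
  refine add_le_add ?_ ?_
  · calc _ ≤ ∫ r in (0 : ℝ)..a, p r * θ := by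
          refine intervalIntegral.integral_mono_on ha0 (hi _ _)
            (Continuous.intervalIntegrable (by fun_prop) _ _) fun r hr =>
              mul_le_mul_of_nonneg_left ?_ (hp0 r)
          rcases le_max_iff.1 hr.2 with h | h
          · have : r = 0 := le_antisymm h hr.1
            simpa [this] using hθ
          · rw [hshift]
            refine le_trans ?_ htail
            exact intervalIntegral.integral_mono_interval (by linarith) (by linarith [hr.1]) hs.2
              (Eventually.of_forall fun _ => norm_nonneg _) (hD.norm.intervalIntegrable _ _)
      _ ≤ _ := by
          rw [intervalIntegral.integral_mul_const]
          refine mul_le_mul_of_nonneg_right (le_trans ?_ hW) hθ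
          exact intervalIntegral.integral_mono_interval le_rfl ha0 (has.trans hs.2)
            (Eventually.of_forall hp0) (hp.intervalIntegrable _ _)
  · calc _ ≤ ∫ r in a..s, p r * C := by
          refine intervalIntegral.integral_mono_on has (hi _ _)
            (Continuous.intervalIntegrable (by fun_prop) _ _) fun r hr =>
              mul_le_mul_of_nonneg_left ?_ (hp0 r)
          rw [hshift]
          refine le_trans ?_ hC
          exact intervalIntegral.integral_mono_interval (by linarith [hr.2])
            (by linarith [hr.1, ha0]) hs.2
            (Eventually.of_forall fun _ => norm_nonneg _) (hD.norm.intervalIntegrable _ _)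
      _ ≤ _ := by
          rw [intervalIntegral.integral_mul_const]
          refine mul_le_mul_of_nonneg_right
            ((integral_le_of_integral_sq_le hp hlam hL ha0 has hs.2).trans ?_) hC0
          have : s - a ≤ η := by linarith [le_max_right 0 (s - η)]
          gcongr

lemma exists_norm_le_of_sublist {α β : Type*} (c : List α → List β → ℂ) (hs : List α)
    (gs : List β) : ∃ K : ℝ, 0 ≤ K ∧
      ∀ hs' gs', hs'.Sublist hs → gs'.Sublist gs → ‖c hs' gs'‖ ≤ K := by
  have hnn : ∀ x ∈ (hs.sublists ×ˢ gs.sublists).map fun p => ‖c p.1 p.2‖, 0 ≤ x := by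
    simp only [List.mem_map]
    rintro _ ⟨p, _, rfl⟩
    exact norm_nonneg _
  refine ⟨((hs.sublists ×ˢ gs.sublists).map fun p => ‖c p.1 p.2‖).sum, List.sum_nonneg hnn, ?_⟩
  intro hs' gs' h₁ h₂
  refine List.single_le_sum hnn _ (List.mem_map.2 ⟨(hs', gs'), ?_, rfl⟩)
  exact List.mem_product.2 ⟨List.mem_sublists.2 h₁, List.mem_sublists.2 h₂⟩

/-! ### Convergence for families of couplings -/

namespace Coupling

variable {α β : Type*}

lemma IsContinuous.exists_bounds {P : Coupling α β} (hP : P.IsContinuous) (T : ℝ) (hs : List α)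
    (gs : List β) : ∃ K C W, P.Bounds K C W T hs gs := by
  obtain ⟨K, hK, h⟩ := exists_norm_le_of_sublist P.c hs gs
  exact ⟨K, _, _, hP, hK, h, le_rfl, le_rfl⟩

lemma IsContinuous.summable_term {P : Coupling α β} (hP : P.IsContinuous) (i : Fin 2) {t : ℝ}
    (ht : 0 ≤ t) (hs : List α) (gs : List β) : Summable fun n => P.term n i t [] hs gs := by
  obtain ⟨K, C, W, h⟩ := hP.exists_bounds t hs gs
  exact h.summable_term i ⟨ht, le_rfl⟩

/-- If the commutator functions tend to `b δ`, and the pairings with the field operators are bounded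
in `L²`, then the Dyson series and the normally ordered series approach each other. -/
theorem tendsto_tsum_sub_tsum_free {ι : Type*} {l : Filter ι} {b : ℂ} (P : ι → Coupling α β)
    (hP : ∀ ε, (P ε).IsContinuous) (hb : ∀ ε, (P ε).b = b) (c : List α → List β → ℂ)
    (hc : ∀ ε, (P ε).c = c) (hD : TendstoHalfDelta (fun ε => (P ε).D) l b) (hs : List α)
    (gs : List β) {t T : ℝ} (hT : 0 < T) (ht : t ∈ Set.Icc 0 T) (i : Fin 2)
    (hL : ∃ L, ∀ᶠ ε in l, ∫ s in (0 : ℝ)..T, (P ε).pairingNorm hs gs s ^ 2 ≤ L) :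
    Tendsto (fun ε => (∑' n, (P ε).term n i t [] hs gs) - ∑' n, (P ε).free.term n i t [] hs gs) l
      (𝓝 0) := by
  obtain ⟨K, hK, hcK⟩ := exists_norm_le_of_sublist c hs gs
  obtain ⟨C, hC⟩ := hD.bounded T hT
  obtain ⟨L, hL⟩ := hL
  -- The `L¹` bound that `integral_le_of_integral_sq_le` gives on `[0, T]` with parameter `1`.
  set W : ℝ := (1 * L + (T - 0) / 1) / 2 with hW
  set M : ℝ := K * Real.exp ((‖b‖ + C) * T + W) with hM
  set Q : ℝ := (1 + W) ^ (hs.length + gs.length + 1) with hQ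
  -- A nontrivial filter is needed to know `0 ≤ L`, by evaluating the bound at some `ε`.
  by_cases hl : l = ⊥
  · simp [hl]
  have : l.NeBot := ⟨hl⟩
  have hW0 : 0 ≤ W := by
    obtain ⟨ε, hε⟩ := hL.exists
    have : 0 ≤ L := (intervalIntegral.integral_nonneg hT.le fun _ _ => sq_nonneg _).trans hε
    simp only [hW]
    linarith
  have hQ0 : 0 < Q := by positivity
  rw [Metric.tendsto_nhds]
  intro δ hδ
  set κ := δ / (2 * Q) with hκ
  have hκ0 : 0 < κ := by positivity
  -- With `η = lam ^ 2` and `θ = lam` the quotient `η / lam` equals `lam`, so one parameter tending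
  -- to `0` makes every error small.
  obtain ⟨lam, ⟨hlamκ, hlamT⟩, hlam⟩ : ∃ lam : ℝ, (M * ((lam ^ 2 * (‖b‖ + C) + T * (2 * lam))
      + T * (W * lam + (lam * L + lam) / 2 * C)) < κ ∧ lam ^ 2 < T) ∧ 0 < lam := by
    have h₁ : Tendsto (fun lam : ℝ => M * ((lam ^ 2 * (‖b‖ + C) + T * (2 * lam))
        + T * (W * lam + (lam * L + lam) / 2 * C))) (𝓝[>] 0) (𝓝 0) :=
      tendsto_nhdsWithin_of_tendsto_nhds (Continuous.tendsto' (by fun_prop) _ _ (by simp))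
    have h₂ : Tendsto (fun lam : ℝ => lam ^ 2) (𝓝[>] 0) (𝓝 0) :=
      tendsto_nhdsWithin_of_tendsto_nhds (Continuous.tendsto' (by fun_prop) _ _ (by simp))
    exact (((h₁.eventually_lt_const hκ0).and (h₂.eventually_lt_const hT)).and
      self_mem_nhdsWithin).exists
  have hη : 0 < lam ^ 2 := by positivity
  have htail := (hD.tail (lam ^ 2) T hη hlamT).eventually_le_const hlam
  have hmass : ∀ᶠ ε in l, ‖b - ∫ s in (0 : ℝ)..lam ^ 2, (P ε).D s‖ ≤ lam := by
    have := ((hD.mass (lam ^ 2) hη).const_sub b).norm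
    rw [sub_self, norm_zero] at this
    exact this.eventually_le_const hlam
  filter_upwards [hC, hL, htail, hmass] with ε hC hL htail hmass
  have hPε := hP ε
  have hp := hPε.pairingNorm hs gs
  have hB : (P ε).Bounds K C W T hs gs :=
    { continuous := hPε
      nonneg := hK
      scalar := by rw [hc]; exact hcK
      commutator := hC
      pairing := integral_le_of_integral_sq_le hp one_pos hL le_rfl hT.le le_rfl }
  have h₁ : ∫ x in (0 : ℝ)..T, ‖(P ε).b - ∫ y in (0 : ℝ)..x, (P ε).D y‖
      ≤ lam ^ 2 * (‖b‖ + C) + T * (2 * lam) := by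
    rw [hb]
    exact integral_norm_sub_primitive_le hPε.D hη hlamT hC htail hmass
  have h₂ : ∀ s ∈ Set.Icc 0 T, ∫ r in (0 : ℝ)..s,
      (P ε).pairingNorm hs gs r * ∫ x in (0 : ℝ)..r, ‖(P ε).D (s - x)‖
      ≤ W * lam + (lam * L + lam) / 2 * C := fun s hs' => by
    have := integral_mul_integral_norm_le hPε.D hp (pairingNorm_nonneg hs gs) hη hlam hC htail
      hlam.le hB.pairing hL hs'
    have e : lam ^ 2 / lam = lam := by field_simp
    rwa [e] at this
  have hfin := hB.norm_tsum_sub_tsum_free_le h₁ h₂ hκ0.le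
    (by rw [totalBound, hb]; exact hlamκ) i ht
  rw [dist_zero_right]
  refine hfin.trans_lt ?_
  have : κ * Q = δ / 2 := by
    rw [hκ]
    field_simp
  rw [← hQ, this]
  linarith

lemma exists_integral_add_sq_le {ι : Type*} {l : Filter ι} {T : ℝ} (hT : 0 ≤ T)
    {f g : ι → ℝ → ℝ} (hf : ∀ ε, Continuous (f ε)) (hg : ∀ ε, Continuous (g ε))
    (hfL : ∃ L, ∀ᶠ ε in l, ∫ s in (0 : ℝ)..T, f ε s ^ 2 ≤ L)
    (hgL : ∃ L, ∀ᶠ ε in l, ∫ s in (0 : ℝ)..T, g ε s ^ 2 ≤ L) :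
    ∃ L, ∀ᶠ ε in l, ∫ s in (0 : ℝ)..T, (f ε s + g ε s) ^ 2 ≤ L := by
  obtain ⟨L₁, h₁⟩ := hfL
  obtain ⟨L₂, h₂⟩ := hgL
  refine ⟨2 * L₁ + 2 * L₂, ?_⟩
  filter_upwards [h₁, h₂] with ε h₁ h₂
  have hf := hf ε
  have hg := hg ε
  calc _ ≤ ∫ s in (0 : ℝ)..T, (2 * f ε s ^ 2 + 2 * g ε s ^ 2) :=
        intervalIntegral.integral_mono_on hT (Continuous.intervalIntegrable (by fun_prop) _ _)
          (Continuous.intervalIntegrable (by fun_prop) _ _) fun s _ => by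
            linarith [sq_nonneg (f ε s - g ε s)]
    _ = 2 * (∫ s in (0 : ℝ)..T, f ε s ^ 2) + 2 * ∫ s in (0 : ℝ)..T, g ε s ^ 2 := by
        rw [intervalIntegral.integral_add (Continuous.intervalIntegrable (by fun_prop) _ _)
          (Continuous.intervalIntegrable (by fun_prop) _ _),
          intervalIntegral.integral_const_mul, intervalIntegral.integral_const_mul]
    _ ≤ _ := by linarith

lemma exists_integral_sum_sq_le {ι γ : Type*} {l : Filter ι} {T : ℝ} (hT : 0 ≤ T) (L : List γ)
    {f : γ → ι → ℝ → ℝ} (hf : ∀ x ε, Continuous (f x ε))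
    (h : ∀ x ∈ L, ∃ B, ∀ᶠ ε in l, ∫ s in (0 : ℝ)..T, f x ε s ^ 2 ≤ B) :
    ∃ B, ∀ᶠ ε in l, ∫ s in (0 : ℝ)..T, (L.map fun x => f x ε s).sum ^ 2 ≤ B := by
  induction L with
  | nil => exact ⟨0, by simp⟩
  | cons x L ih =>
    simp only [List.map_cons, List.sum_cons]
    refine exists_integral_add_sq_le hT (hf x) (fun ε => ?_) (h x (by simp))
      (ih fun y hy => h y (by simp [hy]))
    simp only [← eraseSum_const]
    exact continuous_finsetSum _ fun _ _ => hf _ ε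

end Coupling

/-! ### A Schur test for one-parameter families of vectors -/

section Hilbert

variable {E : Type*} [NormedAddCommGroup E] [InnerProductSpace ℂ E]

/-- The square of `‖φ s - φ r‖` is a combination of four values of the Gram kernel, which cancel at
`s = r`. -/
lemma continuous_of_continuous_inner {φ : ℝ → E}
    (h : Continuous fun p : ℝ × ℝ => (inner ℂ (φ p.1) (φ p.2) : ℂ)) : Continuous φ := by
  refine continuous_iff_continuousAt.2 fun r => tendsto_iff_norm_sub_tendsto_zero.2 ?_
  have hsq : ∀ s, ‖φ s - φ r‖ = √(Complex.re ((inner ℂ (φ s) (φ s) - inner ℂ (φ s) (φ r))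
      - (inner ℂ (φ r) (φ s) - inner ℂ (φ r) (φ r)))) := by
    intro s
    rw [← inner_sub_right, ← inner_sub_right, ← inner_sub_left, @norm_eq_sqrt_re_inner ℂ]
    rfl
  simp only [hsq]
  have hc : Continuous fun s => √(Complex.re ((inner ℂ (φ s) (φ s) - inner ℂ (φ s) (φ r))
      - (inner ℂ (φ r) (φ s) - inner ℂ (φ r) (φ r)))) := by
    have h₁ := h.comp (by fun_prop : Continuous fun s : ℝ => (s, s))
    have h₂ := h.comp (by fun_prop : Continuous fun s : ℝ => (s, r))
    have h₃ := h.comp (by fun_prop : Continuous fun s : ℝ => (r, s))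
    simp only [Function.comp_def] at h₁ h₂ h₃
    fun_prop
  exact hc.tendsto' r 0 (by simp)

/-- The Schur test for the analysis operator `g ↦ ⟪φ s, g⟫` of a continuous family `φ` whose Gram
kernel is dominated by a convolution kernel. -/
lemma integral_norm_inner_sq_le [CompleteSpace E] {φ : ℝ → E} (hφ : Continuous φ) {q : ℝ → ℝ}
    (hq : Continuous q) (hq0 : ∀ s, 0 ≤ q s) {T C : ℝ} (hT : 0 ≤ T)
    (hC : ∫ s in (0 : ℝ)..T, q s ≤ C)
    (h : ∀ s r, 0 ≤ r → r ≤ s → s ≤ T → ‖(inner ℂ (φ s) (φ r) : ℂ)‖ ≤ q (s - r)) (g : E) :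
    ∫ s in (0 : ℝ)..T, ‖(inner ℂ (φ s) g : ℂ)‖ ^ 2 ≤ 2 * C * ‖g‖ ^ 2 := by
  set u : ℝ → ℂ := fun s => inner ℂ (φ s) g with hu
  have huc : Continuous u := hφ.inner continuous_const
  set k : ℝ → ℝ → ℂ := fun s r => inner ℂ (φ s) (φ r) with hk
  have hkc : Continuous fun p : ℝ × ℝ => k p.1 p.2 :=
    (hφ.comp continuous_fst).inner (hφ.comp continuous_snd)
  have hks : ∀ s, Continuous (k s) := fun s => continuous_const.inner hφ
  have hksym : ∀ s r, ‖k s r‖ = ‖k r s‖ := fun s r => norm_inner_symm _ _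
  set X := ∫ s in (0 : ℝ)..T, ‖u s‖ ^ 2 with hX
  have hX0 : 0 ≤ X := intervalIntegral.integral_nonneg hT fun _ _ => sq_nonneg _
  -- `Φ` is the adjoint of the analysis operator applied to `u`. Pairing it with `g` returns `X`, so
  -- `X² ≤ ‖g‖² ‖Φ‖²`, and the Schur bound `‖Φ‖² ≤ 2 * C * X` closes the estimate.
  set Φ : E := ∫ s in (0 : ℝ)..T, u s • φ s with hΦ
  have hint : IntervalIntegrable (fun s => u s • φ s) volume 0 T :=
    (huc.smul hφ).intervalIntegrable _ _
  have hinner : ∀ y : E, (inner ℂ y Φ : ℂ) = ∫ s in (0 : ℝ)..T, u s * inner ℂ y (φ s) := by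
    intro y
    have := (innerSL ℂ y).intervalIntegral_comp_comm hint
    simpa using this.symm
  -- The domination is assumed only for `r ≤ s`; the other half follows by symmetry of the kernel,
  -- hence the factor `2`.
  have hkC : ∀ s ∈ Set.Icc 0 T, ∫ r in (0 : ℝ)..T, ‖k s r‖ ≤ 2 * C := by
    intro s hs
    have hi : ∀ a c, IntervalIntegrable (fun r => ‖k s r‖) volume a c := fun a c =>
      (hks s).norm.intervalIntegrable a c
    have hle : ∀ x ∈ Set.Icc 0 T, ∫ r in (0 : ℝ)..x, q r ≤ C := fun x hx =>
      (intervalIntegral.integral_mono_interval le_rfl hx.1 hx.2 (Eventually.of_forall hq0)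
        (hq.intervalIntegrable _ _)).trans hC
    rw [← intervalIntegral.integral_add_adjacent_intervals (hi 0 s) (hi s T), two_mul]
    refine add_le_add ?_ ?_
    · calc _ ≤ ∫ r in (0 : ℝ)..s, q (s - r) :=
            intervalIntegral.integral_mono_on hs.1 (hi _ _)
              (Continuous.intervalIntegrable (by fun_prop) _ _)
              fun r hr => h s r hr.1 hr.2 hs.2
        _ ≤ C := by
            rw [intervalIntegral.integral_comp_sub_left q s, sub_self, sub_zero]
            exact hle s hs
    · calc _ ≤ ∫ r in s..T, q (r - s) := by
            refine intervalIntegral.integral_mono_on hs.2 (hi _ _)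
              (Continuous.intervalIntegrable (by fun_prop) _ _) fun r hr => ?_
            rw [hksym]
            exact h r s hs.1 hr.1 hr.2
        _ ≤ C := by
            rw [intervalIntegral.integral_comp_sub_right q s, sub_self]
            exact hle _ ⟨by linarith [hs.2], by linarith [hs.1]⟩
  have hΦg : ‖(inner ℂ g Φ : ℂ)‖ = X := by
    have : ∀ s, u s * inner ℂ g (φ s) = ((‖u s‖ ^ 2 : ℝ) : ℂ) := fun s => by
      rw [← inner_conj_symm g, Complex.mul_conj, Complex.normSq_eq_norm_sq]
    rw [hinner]
    simp only [this]
    rw [intervalIntegral.integral_ofReal, Complex.norm_real, Real.norm_of_nonneg hX0]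
  have hΦΦ : ‖Φ‖ ^ 2 ≤ 2 * C * X := by
    have hdouble : ‖Φ‖ ^ 2 ≤ ∫ s in (0 : ℝ)..T, ‖u s‖ * ∫ r in (0 : ℝ)..T, ‖u r‖ * ‖k s r‖ := by
      have hpar : Continuous fun s => ∫ r in (0 : ℝ)..T, ‖u r‖ * ‖k s r‖ :=
        intervalIntegral.continuous_parametric_intervalIntegral_of_continuous'
          (f := fun s r => ‖u r‖ * ‖k s r‖)
          (((huc.comp continuous_snd).norm).mul hkc.norm) 0 T
      have : ‖Φ‖ ^ 2 = ‖(inner ℂ Φ Φ : ℂ)‖ := by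
        rw [inner_self_eq_norm_sq_to_K]
        simp
      rw [this, hinner]
      refine intervalIntegral.norm_integral_le_of_norm_le hT (Eventually.of_forall fun s hs => ?_)
        (Continuous.intervalIntegrable (by fun_prop) _ _)
      rw [norm_mul, norm_inner_symm Φ (φ s), hinner]
      refine mul_le_mul_of_nonneg_left ?_ (norm_nonneg _)
      refine (intervalIntegral.norm_integral_le_integral_norm hT).trans (le_of_eq ?_)
      simp only [norm_mul, hk]
    have hA : Continuous fun p : ℝ × ℝ => ‖u p.1‖ ^ 2 * ‖k p.1 p.2‖ :=
      ((huc.comp continuous_fst).norm.pow 2).mul hkc.norm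
    have hB : Continuous fun p : ℝ × ℝ => ‖u p.2‖ ^ 2 * ‖k p.1 p.2‖ :=
      ((huc.comp continuous_snd).norm.pow 2).mul hkc.norm
    have hA' := intervalIntegral.continuous_parametric_intervalIntegral_of_continuous'
      (μ := volume) (f := fun s r => ‖u s‖ ^ 2 * ‖k s r‖) hA 0 T
    have hB' := intervalIntegral.continuous_parametric_intervalIntegral_of_continuous'
      (μ := volume) (f := fun s r => ‖u r‖ ^ 2 * ‖k s r‖) hB 0 T
    have hAB : ∫ s in (0 : ℝ)..T, ∫ r in (0 : ℝ)..T, ‖u r‖ ^ 2 * ‖k s r‖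
        = ∫ s in (0 : ℝ)..T, ∫ r in (0 : ℝ)..T, ‖u s‖ ^ 2 * ‖k s r‖ := by
      rw [intervalIntegral_intervalIntegral_swap]
      · simp only [hksym]
      · exact (hB.continuousOn.integrableOn_compact (isCompact_uIcc.prod isCompact_uIcc)).mono_set
          (Set.prod_mono Set.uIoc_subset_uIcc Set.uIoc_subset_uIcc)
    have hsum : ∫ s in (0 : ℝ)..T, ‖u s‖ * ∫ r in (0 : ℝ)..T, ‖u r‖ * ‖k s r‖
        ≤ ∫ s in (0 : ℝ)..T, ((1 / 2) * (∫ r in (0 : ℝ)..T, ‖u s‖ ^ 2 * ‖k s r‖)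
          + (1 / 2) * ∫ r in (0 : ℝ)..T, ‖u r‖ ^ 2 * ‖k s r‖) := by
      have hpar : Continuous fun s => ∫ r in (0 : ℝ)..T, ‖u r‖ * ‖k s r‖ :=
        intervalIntegral.continuous_parametric_intervalIntegral_of_continuous'
          (f := fun s r => ‖u r‖ * ‖k s r‖)
          (((huc.comp continuous_snd).norm).mul hkc.norm) 0 T
      refine intervalIntegral.integral_mono_on hT
        (Continuous.intervalIntegrable (by fun_prop) _ _)
        (Continuous.intervalIntegrable (by fun_prop) _ _) fun s _ => ?_
      have hks := hks s
      rw [← intervalIntegral.integral_const_mul, ← intervalIntegral.integral_const_mul,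
        ← intervalIntegral.integral_const_mul, ← intervalIntegral.integral_add
          (Continuous.intervalIntegrable (by fun_prop) _ _)
          (Continuous.intervalIntegrable (by fun_prop) _ _)]
      refine intervalIntegral.integral_mono_on hT
        (Continuous.intervalIntegrable (by fun_prop) _ _)
        (Continuous.intervalIntegrable (by fun_prop) _ _) fun r _ => ?_
      nlinarith [mul_nonneg (sq_nonneg (‖u s‖ - ‖u r‖)) (norm_nonneg (k s r))]
    refine hdouble.trans (hsum.trans ?_)
    rw [intervalIntegral.integral_add (Continuous.intervalIntegrable (by fun_prop) _ _)
      (Continuous.intervalIntegrable (by fun_prop) _ _), intervalIntegral.integral_const_mul,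
      intervalIntegral.integral_const_mul, hAB, ← add_mul, add_halves, one_mul]
    calc _ ≤ ∫ s in (0 : ℝ)..T, 2 * C * ‖u s‖ ^ 2 := by
          refine intervalIntegral.integral_mono_on hT
            (Continuous.intervalIntegrable (by fun_prop) _ _)
            (Continuous.intervalIntegrable (by fun_prop) _ _) fun s hs => ?_
          rw [intervalIntegral.integral_const_mul, mul_comm]
          exact mul_le_mul_of_nonneg_right (hkC s hs) (sq_nonneg _)
      _ = _ := by rw [intervalIntegral.integral_const_mul]
  have hCS : X ≤ ‖g‖ * ‖Φ‖ := hΦg ▸ norm_inner_le_norm g Φ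
  rcases hX0.eq_or_lt with h0 | hpos
  · rw [← h0]
    have : 0 ≤ C := (intervalIntegral.integral_nonneg hT fun _ _ => hq0 _).trans hC
    positivity
  · have : X * X ≤ (2 * C * ‖g‖ ^ 2) * X := by
      calc X * X ≤ (‖g‖ * ‖Φ‖) * (‖g‖ * ‖Φ‖) := mul_le_mul hCS hCS hX0 (by positivity)
        _ = ‖g‖ ^ 2 * ‖Φ‖ ^ 2 := by ring
        _ ≤ ‖g‖ ^ 2 * (2 * C * X) := mul_le_mul_of_nonneg_left hΦΦ (sq_nonneg _)
        _ = _ := by ring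
    exact le_of_mul_le_mul_right this hpos

end Hilbert

/-! ### Continuity and uniform bounds for the field vectors -/

namespace Model

variable {K : Type*} [MeasurableSpace K] {μ : Measure K} (M : Model μ)

lemma continuous_F : Continuous M.F := by
  have hm := M.measurable_ω
  have hint : Integrable (fun k => ‖M.f k‖ ^ 2) μ :=
    (memLp_two_iff_integrable_sq_norm M.memLp_f.1).1 M.memLp_f
  refine continuous_of_dominated (bound := fun k => ‖M.f k‖ ^ 2) (fun t => ?_) (fun t => ?_) hint
    (Eventually.of_forall fun k => by fun_prop)
  · exact (AEStronglyMeasurable.mul (by fun_prop)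
      (Complex.continuous_ofReal.comp_aestronglyMeasurable hint.1))
  · refine Eventually.of_forall fun k => le_of_eq ?_
    rw [norm_mul, Complex.norm_exp, Complex.norm_real, Real.norm_of_nonneg (sq_nonneg _)]
    simp

lemma continuous_Fr : Continuous M.Fr := by
  have := M.continuous_F
  unfold Fr
  fun_prop

/-- The factors `exp(γ s)` and `exp(-γ r)` combine into a function of `s - r`. -/
lemma inner_annVec_creVec (s r : ℝ) : inner ℂ (M.annVec s) (M.creVec r) = M.Fr (s - r) := by
  rw [L2.inner_def, Fr, F, ← integral_const_mul]
  refine integral_congr_ae ?_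
  filter_upwards [Lp.coeFn_star ((M.memLp_fAt s).toLp (M.fAt s)), (M.memLp_fAt s).coeFn_toLp,
    (M.memLp_fAt' r).coeFn_toLp] with k h₁ h₂ h₃
  rw [annVec, creVec, h₁, h₃, Pi.star_apply, h₂]
  simp only [RCLike.inner_apply, RCLike.star_def, Complex.conj_conj, fAt, fAt']
  rw [mul_mul_mul_comm, ← Complex.exp_add, ← mul_assoc (Complex.exp _) (Complex.exp _),
    ← Complex.exp_add, mul_comm (conj (M.f k)), Complex.mul_conj, Complex.normSq_eq_norm_sq,
    mul_comm]
  congr 2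
  push_cast
  ring_nf

/-- Here the exponentials in `γ` multiply instead of compensating, so the Gram kernel is a
convolution kernel only up to a factor that is bounded on `[0, T]`. -/
lemma inner_annVec (s r : ℝ) : inner ℂ (M.annVec s) (M.annVec r)
    = M.Fr (s - r) * Complex.exp (2 * M.γ * r) := by
  rw [L2.inner_def, Fr, F, ← integral_const_mul, ← integral_mul_const]
  refine integral_congr_ae ?_
  filter_upwards [Lp.coeFn_star ((M.memLp_fAt s).toLp (M.fAt s)), (M.memLp_fAt s).coeFn_toLp,
    Lp.coeFn_star ((M.memLp_fAt r).toLp (M.fAt r)), (M.memLp_fAt r).coeFn_toLp] with k h₁ h₂ h₃ h₄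
  rw [annVec, annVec, h₁, h₃, Pi.star_apply, Pi.star_apply, h₂, h₄]
  simp only [RCLike.inner_apply, RCLike.star_def, Complex.conj_conj, fAt, map_mul,
    ← Complex.exp_conj]
  rw [mul_mul_mul_comm, ← Complex.exp_add, ← mul_assoc (Complex.exp _) (Complex.exp _),
    ← Complex.exp_add, mul_comm (conj (M.f k)), Complex.mul_conj, Complex.normSq_eq_norm_sq,
    mul_right_comm (Complex.exp _) _ (Complex.exp _), ← Complex.exp_add, mul_comm]
  congr 2
  simp only [map_neg, map_mul, map_add, map_sub, Complex.conj_I, Complex.conj_ofReal]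
  push_cast
  linear_combination (M.γ * (-(2:ℂ) * r)) * Complex.I_mul_I

lemma inner_creVec (s r : ℝ) : inner ℂ (M.creVec s) (M.creVec r)
    = M.Fr (s - r) * Complex.exp (-(2 * M.γ * s)) := by
  rw [L2.inner_def, Fr, F, ← integral_const_mul, ← integral_mul_const]
  refine integral_congr_ae ?_
  filter_upwards [(M.memLp_fAt' s).coeFn_toLp, (M.memLp_fAt' r).coeFn_toLp] with k h₁ h₂
  rw [creVec, creVec, h₁, h₂]
  simp only [RCLike.inner_apply, Complex.conj_conj, fAt', map_mul, ← Complex.exp_conj]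
  rw [mul_mul_mul_comm, ← Complex.exp_add, ← mul_assoc (Complex.exp _) (Complex.exp _),
    ← Complex.exp_add, mul_comm (conj (M.f k)), Complex.mul_conj, Complex.normSq_eq_norm_sq,
    mul_right_comm (Complex.exp _) _ (Complex.exp _), ← Complex.exp_add, mul_comm]
  congr 2
  simp only [map_mul, map_add, map_sub, Complex.conj_I, Complex.conj_ofReal]
  push_cast
  linear_combination (M.γ * ((2:ℂ) * s)) * Complex.I_mul_I

lemma continuous_annVec : Continuous M.annVec := by
  refine continuous_of_continuous_inner ?_
  have := M.continuous_Fr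
  simp only [inner_annVec]
  fun_prop

lemma continuous_creVec : Continuous M.creVec := by
  refine continuous_of_continuous_inner ?_
  have := M.continuous_Fr
  simp only [inner_creVec]
  fun_prop

lemma isContinuous_coupling {D : ℝ → ℂ} (hD : Continuous D) (b : ℂ) (j : Fin 2) :
    (M.coupling D b j).IsContinuous where
  w _ := continuous_const.inner M.continuous_creVec
  u _ := M.continuous_annVec.inner continuous_const
  D := hD

/-- Models with the same `b` share the same `γ`; this makes the exponential factors in the Schur
bounds uniform along a family. -/
lemma γ_eq_re_b : M.γ = M.b.re := by simp [b]

lemma integral_exp_mul_norm_Fr_le {T C : ℝ} (hC : ∫ s in (0 : ℝ)..T, ‖M.Fr s‖ ≤ C) (x : ℝ) :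
    ∫ s in (0 : ℝ)..T, Real.exp x * ‖M.Fr s‖ ≤ Real.exp x * C := by
  rw [intervalIntegral.integral_const_mul]
  exact mul_le_mul_of_nonneg_left hC (Real.exp_pos _).le

lemma integral_norm_inner_annVec_sq_le {T C : ℝ} (hT : 0 ≤ T)
    (hC : ∫ s in (0 : ℝ)..T, ‖M.Fr s‖ ≤ C) (g : OnePhoton μ) :
    ∫ s in (0 : ℝ)..T, ‖(inner ℂ (M.annVec s) g : ℂ)‖ ^ 2
      ≤ 2 * (Real.exp (2 * |M.γ| * T) * C) * ‖g‖ ^ 2 := by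
  have hF := M.continuous_Fr
  refine integral_norm_inner_sq_le M.continuous_annVec (by fun_prop) (fun s => by positivity) hT
    (M.integral_exp_mul_norm_Fr_le hC _) (fun s r hr hrs hs => ?_) g
  rw [inner_annVec, norm_mul, mul_comm, Complex.norm_exp]
  refine mul_le_mul_of_nonneg_right (Real.exp_le_exp.2 ?_) (norm_nonneg _)
  have h₁ : M.γ * r ≤ |M.γ| * r := mul_le_mul_of_nonneg_right (le_abs_self _) hr
  have h₂ : |M.γ| * r ≤ |M.γ| * T := mul_le_mul_of_nonneg_left (hrs.trans hs) (abs_nonneg _)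
  simp
  linarith

lemma integral_norm_inner_creVec_sq_le {T C : ℝ} (hT : 0 ≤ T)
    (hC : ∫ s in (0 : ℝ)..T, ‖M.Fr s‖ ≤ C) (h : OnePhoton μ) :
    ∫ s in (0 : ℝ)..T, ‖(inner ℂ h (M.creVec s) : ℂ)‖ ^ 2
      ≤ 2 * (Real.exp (2 * |M.γ| * T) * C) * ‖h‖ ^ 2 := by
  have hF := M.continuous_Fr
  simp only [norm_inner_symm h]
  refine integral_norm_inner_sq_le M.continuous_creVec (by fun_prop) (fun s => by positivity) hT
    (M.integral_exp_mul_norm_Fr_le hC _) (fun s r hr hrs hs => ?_) h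
  rw [inner_creVec, norm_mul, mul_comm, Complex.norm_exp]
  refine mul_le_mul_of_nonneg_right (Real.exp_le_exp.2 ?_) (norm_nonneg _)
  have h₁ : -M.γ * s ≤ |M.γ| * s := mul_le_mul_of_nonneg_right (neg_le_abs _) (hr.trans hrs)
  have h₂ : |M.γ| * s ≤ |M.γ| * T := mul_le_mul_of_nonneg_left hs (abs_nonneg _)
  simp
  linarith

lemma replacedTerm_eq_term {b : ℂ} (hb : M.b = b) (D : ℝ → ℂ) (hs gs : List (OnePhoton μ)) (t : ℝ)
    (i j : Fin 2) :
    M.replacedTerm D hs gs t i j = fun n => (M.coupling D b j).term n i t [] hs gs := by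
  subst hb
  exact funext fun n => M.replacedTerm_eq D hs gs t i j n

lemma summable_replacedTerm {D : ℝ → ℂ} (hD : Continuous D) (hs gs : List (OnePhoton μ)) {t : ℝ}
    (ht : 0 ≤ t) (i j : Fin 2) : Summable (M.replacedTerm D hs gs t i j) := by
  rw [M.replacedTerm_eq_term rfl]
  exact (M.isContinuous_coupling hD M.b j).summable_term i ht hs gs

lemma summable_normalTerm (hs gs : List (OnePhoton μ)) {t : ℝ} (ht : 0 ≤ t) (i j : Fin 2) :
    Summable (M.normalTerm hs gs t i j) := by
  rw [M.summable_normalTerm_iff 0 0]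
  exact (M.isContinuous_coupling continuous_const 0 j).free.summable_term i ht hs gs

/-- The normally ordered Dyson series, with commutator functions tending to `b δ`, and the series of
the `N_{ij}` approach each other if the pairings of the particles are bounded in `L²`. -/
theorem tendsto_tsum_replacedTerm_sub {ι : Type*} {l : Filter ι} {b : ℂ} (M : ι → Model μ)
    (hM : ∀ ε, (M ε).b = b) (D : ι → ℝ → ℂ) (hD : ∀ ε, Continuous (D ε))
    (hDl : TendstoHalfDelta D l b) {t : ℝ} (ht : 0 ≤ t) (i j : Fin 2)
    (hs gs : List (OnePhoton μ))
    (hw : ∀ h, ∃ L, ∀ᶠ ε in l, ∫ s in (0 : ℝ)..(t + 1), ‖(inner ℂ h ((M ε).creVec s) : ℂ)‖ ^ 2 ≤ L)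
    (hu : ∀ g, ∃ L, ∀ᶠ ε in l, ∫ s in (0 : ℝ)..(t + 1), ‖(inner ℂ ((M ε).annVec s) g : ℂ)‖ ^ 2 ≤ L) :
    Tendsto (fun ε => (∑' n, (M ε).replacedTerm (D ε) hs gs t i j n)
      - ∑' n, (M ε).normalTerm hs gs t i j n) l (𝓝 0) := by
  -- The half-line conditions are about positive intervals, while `t` may be `0`; hence the
  -- estimates on `[0, t + 1]`.
  have hT : 0 < t + 1 := by linarith
  have hP : ∀ ε, ((M ε).coupling (D ε) b j).IsContinuous := fun ε =>
    (M ε).isContinuous_coupling (hD ε) b j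
  simp only [fun ε => (M ε).replacedTerm_eq_term (hM ε), fun ε => (M ε).tsum_normalTerm (D ε) b]
  refine Coupling.tendsto_tsum_sub_tsum_free (fun ε => (M ε).coupling (D ε) b j) hP (fun _ => rfl)
    (fun hs gs => matrixElement hs gs 1) (fun _ => rfl) hDl hs gs hT ⟨ht, by linarith⟩ i ?_
  refine Coupling.exists_integral_add_sq_le hT.le (f := fun ε s =>
      (hs.map fun h => ‖((M ε).coupling (D ε) b j).w h s‖).sum) (g := fun ε s =>
      (gs.map fun g => ‖((M ε).coupling (D ε) b j).u g s‖).sum) (fun ε => ?_) (fun ε => ?_)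
    (Coupling.exists_integral_sum_sq_le hT.le hs (fun h ε => ((hP ε).w h).norm) fun h _ => hw h)
    (Coupling.exists_integral_sum_sq_le hT.le gs (fun g ε => ((hP ε).u g).norm) fun g _ => hu g)
  · simp only [← eraseSum_const]
    exact continuous_finsetSum _ fun _ _ => ((hP ε).w _).norm
  · simp only [← eraseSum_const]
    exact continuous_finsetSum _ fun _ _ => ((hP ε).u _).norm

end Model

end AtomField

/-! ### The theorem -/

theorem theorem1 {K : Type*} [MeasurableSpace K] (μ : MeasureTheory.Measure K)
    {ι : Type*} (l : Filter ι) (b : ℂ) (t : ℝ) (ht : 0 ≤ t)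
    (i j : Fin 2) (hs gs : List (AtomField.OnePhoton μ)) :
    -- the rule `F^r ⇒ b δ`, applied after normal ordering at every order of the Dyson series
    (∀ (M : AtomField.Model μ) (D : ι → ℝ → ℂ), M.b = b → (∀ ε, Continuous (D ε)) →
      AtomField.TendstoHalfDelta D l b →
        (∀ ε, Summable (M.replacedTerm (D ε) hs gs t i j)) ∧
        Summable (M.normalTerm hs gs t i j) ∧
        Tendsto (fun ε => ∑' n, M.replacedTerm (D ε) hs gs t i j n) l
          (𝓝 (∑' n, M.normalTerm hs gs t i j n))) ∧
    -- the propagators themselves, for models whose commutator function `F^r` tends to `b δ`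
    (∀ M : ι → AtomField.Model μ, (∀ ε, (M ε).b = b) →
      AtomField.TendstoHalfDelta (fun ε => (M ε).Fr) l b →
        (∀ ε, Summable ((M ε).propagatorTerm hs gs t i j)) ∧
        (∀ ε, Summable ((M ε).normalTerm hs gs t i j)) ∧
        Tendsto (fun ε => (∑' n, (M ε).propagatorTerm hs gs t i j n)
          - ∑' n, (M ε).normalTerm hs gs t i j n) l (𝓝 0)) := by
  refine ⟨fun M D hM hD hDl => ⟨fun ε => M.summable_replacedTerm (hD ε) hs gs ht i j,
    M.summable_normalTerm hs gs ht i j, ?_⟩, fun M hM hFr => ?_⟩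
  -- For a single model the pairings do not depend on `ε`, so each `L²` integral serves as its own
  -- bound, and the limit series is constant.
  · exact tendsto_sub_nhds_zero_iff.1 (AtomField.Model.tendsto_tsum_replacedTerm_sub (fun _ => M)
      (fun _ => hM) D hD hDl ht i j hs gs (fun h => ⟨_, Eventually.of_forall fun _ => le_rfl⟩)
      fun g => ⟨_, Eventually.of_forall fun _ => le_rfl⟩)
  · have hT : 0 < t + 1 := by linarith
    have hprop : ∀ ε, (M ε).propagatorTerm hs gs t i j
        = (M ε).replacedTerm (M ε).Fr hs gs t i j := fun ε =>
      (M ε).propagatorTerm_eq (M ε).inner_annVec_creVec hs gs t i j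
    simp only [hprop]
    refine ⟨fun ε => (M ε).summable_replacedTerm (M ε).continuous_Fr hs gs ht i j,
      fun ε => (M ε).summable_normalTerm hs gs ht i j, ?_⟩
    -- The `L¹` bound on `F^r` serves twice: for the contractions and, through the Schur test, for
    -- the pairings with the fixed particles.
    obtain ⟨C, hC⟩ := hFr.bounded (t + 1) hT
    have hγ : ∀ ε, (M ε).γ = b.re := fun ε => by rw [(M ε).γ_eq_re_b, hM]
    refine AtomField.Model.tendsto_tsum_replacedTerm_sub M hM _ (fun ε => (M ε).continuous_Fr) hFr
      ht i j hs gs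
      (fun h => ⟨2 * (Real.exp (2 * |b.re| * (t + 1)) * C) * ‖h‖ ^ 2, hC.mono fun ε hε => ?_⟩)
      (fun g => ⟨2 * (Real.exp (2 * |b.re| * (t + 1)) * C) * ‖g‖ ^ 2, hC.mono fun ε hε => ?_⟩)
    · exact hγ ε ▸ (M ε).integral_norm_inner_creVec_sq_le hT.le hε h
    · exact hγ ε ▸ (M ε).integral_norm_inner_annVec_sq_le hT.le hε g
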